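/- Let $s\in\{\tfrac12,1,\tfrac32,\dots\}$, $n\ge 1$ and $0\le k\le 2sn$. On $n$ qudits of dimension $2s+1$ with one-qudit basis $|0\rangle,\dots,|2s\rangle$ (where $|m\rangle$ has $z$-component of spin $s-m$), let $\mathbb S^-$ be the total spin-lowering operator, $S^-|m\rangle=\sqrt{(m+1)(2s-m)}\,|m+1\rangle$ on one qudit, and let $|D^{(s)}_{n,k}\rangle$ be the normalization of $(\mathbb S^-)^k|0\rangle^{\otimes n}$. For $p\in[0,1]$ put $$|\psi(s,p)\rangle=\sum_{m=0}^{2s}\sqrt{\tbinom{2s}{m}}\,(\sqrt p)^m(\sqrt{1-p})^{2s-m}|m\rangle,\qquad P_p(j)=\tbinom{2sn}{j}p^j(1-p)^{2sn-j}.$$ Let $\mathbb K$ be the sum over the $n$ sites of the one-qudit operator $\sum_m m|m\rangle\langle m|$, $\ell=\lceil\log_2(2sn+1)\rceil$ and $U=\exp(2\pi i\mathbb K/2^\ell)$. The standard QPE circuit for $U$ acts on the $n$ qudits and $\ell$ qubits in $|0\rangle$: Hadamard gates on the $\ell$ qubits; $U^{2^j}$ controlled on qubit $j$, for $j=0,\dots,\ell-1$;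 the inverse quantum Fourier transform on the $\ell$ qubits; then the $\ell$ qubits are measured and read as an integer (qubit $j$ having weight $2^j$). Circuits are built from layers of arbitrary unitary gates on disjoint sets of at most two wires, and rounds of measurements of wires in the computational basis; later operations may depend on all earlier outcomes, at no cost for classical processing. The depth is the number of layers and measurement rounds, maximized over the measurement outcomes. There is an absolute constant $c$ such that the following holds for all $s$ and $n$ as above. There is a circuit $Q$ (independent of $k$) on the $n$ qudits, the $\ell$ QPE qubits and $b$ further qubits that start in $|0\rangle$, with at most $c\,(\log(2sn+1)+n)$ ancilla qubits in total ($\ell+b$), which realizes exactly, on every input state of the $n$ qudits, the standard QPE circuit for $U$ before its final measurement: for all measurement outcomes inside $Q$, the qudits and the QPE qubits end in the QPE state, in a product with a basis state of the further qubits. Moreover, for all $0\le k\le 2sn$ and $p=k/(2sn)$: 1. just before the final measurement, QPE applied to $|\psi(s,p)\rangle^{\otimes n}$ yields $\sum_{j=0}^{2sn}\sqrt{P_p(j)}\,|D^{(s)}_{n,j}\rangle|j\rangle$; 2. $|0\rangle^{\otimes n}$ is mapped to $|\psi(s,p)\rangle^{\otimes n}$ by one layer of one-qudit gates, and this layer,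 followed by $Q$ and the measurement of the QPE qubits, has depth at most $c\log(2sn+1)$, i.e. $O(\log(sn))$; 3. the value $k$ is read with probability exactly $P(k)=\binom{2sn}{k}p^k(1-p)^{2sn-k}$, and whenever it is read the qudits are exactly in the state $|D^{(s)}_{n,k}\rangle$ (in a product with the ancillas); 4. the expected number of independent repetitions up to the first success is $1/P(k)\le c\sqrt{sn}$. -/

import Mathlib

/-! ### Kets and operators

A ket on a system with orthonormal basis `X` is its family of amplitudes `X → ℂ`. -/

/-- Kets with computational basis indexed by `X`. -/
abbrev Ket (X : Type) : Type := X → ℂ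

/-- Basis vector `|x⟩`. -/
def basisKet {X : Type} [DecidableEq X] (x : X) : Ket X := Pi.single x 1

/-- The squared norm of a ket. -/
noncomputable def ketNormSq {X : Type} [Fintype X] (χ : Ket X) : ℝ := ∑ x, ‖χ x‖ ^ 2

/-- The product ket `|f⟩ ⊗ |g⟩`. -/
def ketTensor {X Y : Type} (f : Ket X) (g : Ket Y) : Ket (X × Y) := fun z => f z.1 * g z.2

/-- The `n`-fold tensor power `|f⟩^{⊗ n}`. -/
def ketPow {X : Type} (n : ℕ) (f : Ket X) : Ket (Fin n → X) := fun m => ∏ i, f (m i)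

/-- The operator `I ⊗ ⋯ ⊗ A ⊗ ⋯ ⊗ I` with `A` at site `i`. -/
def siteOp {X : Type} [DecidableEq X] {n : ℕ} (i : Fin n) (A : Matrix X X ℂ) :
    Matrix (Fin n → X) (Fin n → X) ℂ :=
  fun x y => if ∀ j, j ≠ i → x j = y j then A (x i) (y i) else 0

/-! ### Spin-`s` Dicke states

Throughout `t = 2 s`, and a spin-`s` qudit has basis `|0⟩, …, |2s⟩`, where `|m⟩` has
`z`-component `s - m`. -/

/-- Basis labels of `n` spin-`s` qudits. -/
abbrev SysConfig (t n : ℕ) : Type := Fin n → Fin (t + 1)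

/-- One-qudit lowering operator, `S⁻ |m⟩ = √((m + 1) (2s - m)) |m + 1⟩`. -/
noncomputable def lowering (t : ℕ) : Matrix (Fin (t + 1)) (Fin (t + 1)) ℂ :=
  fun a m => if (a : ℕ) = (m : ℕ) + 1 then
    ((Real.sqrt (((m : ℝ) + 1) * ((t : ℝ) - (m : ℝ))) : ℝ) : ℂ) else 0

/-- Total lowering operator of `n` spins. -/
noncomputable def totalLowering (t n : ℕ) : Matrix (SysConfig t n) (SysConfig t n) ℂ :=
  ∑ i, siteOp i (lowering t)

/-- The unnormalized state `(S⁻)^k |0⟩^{⊗ n}`. -/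
noncomputable def rawDicke (t n k : ℕ) : Ket (SysConfig t n) :=
  (totalLowering t n ^ k).mulVec (basisKet (fun _ => 0))

/-- The spin-`s` Dicke state `|D^{(s)}_{n,k}⟩`: the normalization of `(S⁻)^k |0⟩^{⊗ n}`. -/
noncomputable def dicke (t n k : ℕ) : Ket (SysConfig t n) :=
  (((Real.sqrt (ketNormSq (rawDicke t n k)))⁻¹ : ℝ) : ℂ) • rawDicke t n k

/-- The one-qudit state `|ψ(s,p)⟩`. For `p < 1` the amplitude of `|m⟩` is
`(1-p)^s (√(p/(1-p)))^m √(binom (2s) m)`; the form used here also makes sense at `p = 1`. -/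
noncomputable def psi (t : ℕ) (p : ℝ) : Ket (Fin (t + 1)) :=
  fun m => ((Real.sqrt (1 - p) ^ (t - (m : ℕ)) * Real.sqrt p ^ (m : ℕ) *
    Real.sqrt (t.choose (m : ℕ)) : ℝ) : ℂ)

/-- The one-qudit operator `∑ m, m |m⟩⟨m|`. -/
def levelOp (t : ℕ) : Matrix (Fin (t + 1)) (Fin (t + 1)) ℂ :=
  Matrix.diagonal fun m => ((m : ℕ) : ℂ)

/-- The operator `K`, the sum of the one-qudit operators over all sites. -/
def totalLevelOp (t n : ℕ) : Matrix (SysConfig t n) (SysConfig t n) ℂ :=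
  ∑ i, siteOp i (levelOp t)

/-- The unitary `U = exp (2 π i K / 2^ℓ)`. -/
noncomputable def phaseU (t n ℓ : ℕ) : Matrix (SysConfig t n) (SysConfig t n) ℂ :=
  NormedSpace.exp ((2 * (Real.pi : ℂ) * Complex.I / 2 ^ ℓ) • totalLevelOp t n)

/-- Success probability `P(k) = binom (2sn) k · p^k (1-p)^(2sn-k)`. -/
noncomputable def successP (t n : ℕ) (p : ℝ) (k : ℕ) : ℝ :=
  ((t * n).choose k : ℝ) * p ^ k * (1 - p) ^ (t * n - k)

/-- Number of readout qubits, `ℓ = ⌈log₂ (2sn + 1)⌉`. -/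
noncomputable def readoutBits (t n : ℕ) : ℕ := ⌈Real.logb 2 ((t : ℝ) * n + 1)⌉₊

/-! ### Standard quantum phase estimation -/

/-- Basis labels of an `ℓ`-qubit register. -/
abbrev RegConfig (ℓ : ℕ) : Type := Fin ℓ → Fin 2

/-- The integer stored in a register; qubit `j` has weight `2^j`. -/
def regVal {ℓ : ℕ} (x : RegConfig ℓ) : ℕ := ∑ j, (x j : ℕ) * 2 ^ (j : ℕ)

/-- The register basis state `|k⟩`. -/
def regKet (ℓ k : ℕ) : Ket (RegConfig ℓ) := fun x => if regVal x = k then 1 else 0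

/-- The Hadamard gate on every qubit of the register. -/
noncomputable def hadamardAll (ℓ : ℕ) : Matrix (RegConfig ℓ) (RegConfig ℓ) ℂ :=
  fun x y => ∏ j, (((Real.sqrt 2)⁻¹ : ℝ) : ℂ) * (-1) ^ ((x j : ℕ) * (y j : ℕ))

/-- The quantum Fourier transform on the register. -/
noncomputable def qft (ℓ : ℕ) : Matrix (RegConfig ℓ) (RegConfig ℓ) ℂ :=
  fun x y => (((Real.sqrt (2 ^ ℓ))⁻¹ : ℝ) : ℂ) *
    Complex.exp (2 * (Real.pi : ℂ) * Complex.I * (regVal x : ℂ) * (regVal y : ℂ) / 2 ^ ℓ)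

/-- `M` applied to the system, controlled on register qubit `j` being `1`. -/
def controlledOp {X : Type} [DecidableEq X] {ℓ : ℕ} (j : Fin ℓ) (M : Matrix X X ℂ) :
    Matrix (X × RegConfig ℓ) (X × RegConfig ℓ) ℂ :=
  Matrix.blockDiagonal fun x : RegConfig ℓ => if x j = 1 then M else 1

/-- The state produced, just before the register is measured, by the standard phase estimation
circuit for `U` with `ℓ` register qubits on the input `φ`: Hadamards on the register `|0…0⟩`,
then `U^(2^j)` controlled on qubit `j` for `j = 0, …, ℓ-1`, then the inverse Fourier transform. -/
noncomputable def qpe {X : Type} [Fintype X] [DecidableEq X] (ℓ : ℕ) (U : Matrix X X ℂ)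
    (φ : Ket X) : Ket (X × RegConfig ℓ) :=
  (Matrix.kronecker (1 : Matrix X X ℂ) (qft ℓ).conjTranspose).mulVec
    ((List.finRange ℓ).foldl
      (fun χ j => (controlledOp j (U ^ (2 ^ (j : ℕ)))).mulVec χ)
      ((Matrix.kronecker (1 : Matrix X X ℂ) (hadamardAll ℓ)).mulVec
        (ketTensor φ (basisKet (fun _ => 0)))))

/-! ### Circuits with mid-circuit measurement and feedforward

`W` is the set of wires and wire `w` carries a qudit of dimension `d w`. -/

/-- Basis labels of all wires. -/
abbrev Config {W : Type} (d : W → ℕ) : Type := ∀ w, Fin (d w)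

/-- Basis labels of the wires in `S`. -/
abbrev LocalConfig {W : Type} (d : W → ℕ) (S : Finset W) : Type := ∀ w : S, Fin (d w)

/-- The part of a basis label on the wires in `S`. -/
def localPart {W : Type} {d : W → ℕ} (S : Finset W) (x : Config d) : LocalConfig d S :=
  fun w => x w

/-- Replace the labels of the wires in `S`. -/
def overrideOn {W : Type} [DecidableEq W] {d : W → ℕ} {S : Finset W} (x : Config d)
    (y : LocalConfig d S) : Config d :=
  fun w => if h : w ∈ S then y ⟨w, h⟩ else x w

/-- An elementary gate: a unitary acting on at most two wires. -/
structure Gate {W : Type} [DecidableEq W] (d : W → ℕ) where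
  support : Finset W
  card_le : support.card ≤ 2
  op : Matrix (LocalConfig d support) (LocalConfig d support) ℂ
  unitary : op ∈ Matrix.unitaryGroup (LocalConfig d support) ℂ

/-- The action of a gate on a state of all wires (identity outside its support). -/
def Gate.apply {W : Type} [DecidableEq W] {d : W → ℕ} (g : Gate d) (χ : Ket (Config d)) :
    Ket (Config d) :=
  fun x => ∑ y, g.op (localPart g.support x) y * χ (overrideOn x y)

/-- A layer: gates on pairwise disjoint sets of wires, executed in parallel. -/
structure Layer {W : Type} [DecidableEq W] (d : W → ℕ) where
  gates : List (Gate d)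
  disjoint : gates.Pairwise fun g h => Disjoint g.support h.support

/-- The action of a layer. -/
def Layer.apply {W : Type} [DecidableEq W] {d : W → ℕ} (L : Layer d) (χ : Ket (Config d)) :
    Ket (Config d) :=
  L.gates.foldl (fun χ g => g.apply χ) χ

/-- Unnormalized state after measuring the wires in `S` in the computational basis with
outcome `o`; its squared norm carries the probability of the outcome. -/
def collapse {W : Type} [DecidableEq W] {d : W → ℕ} (S : Finset W) (o : LocalConfig d S)
    (χ : Ket (Config d)) : Ket (Config d) :=
  fun x => if localPart S x = o then χ x else 0

/-- An adaptive circuit with classical output in `α`: at each step it stops, performs one layer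
of gates, or measures some wires; all later steps may depend on the outcomes. -/
inductive Circuit {W : Type} [DecidableEq W] (d : W → ℕ) (α : Type) : Type where
  | halt (a : α) : Circuit d α
  | layer (L : Layer d) (next : Circuit d α) : Circuit d α
  | measure (S : Finset W) (next : LocalConfig d S → Circuit d α) : Circuit d α

/-- Depth: each layer of gates and each round of measurements counts `1`; the depth is the
maximum over all measurement records. -/
def Circuit.depth {W : Type} [DecidableEq W] {d : W → ℕ} {α : Type} : Circuit d α → ℕ
  | .halt _ => 0
  | .layer _ next => next.depth + 1
  | .measure _ next => (Finset.univ.sup fun o => (next o).depth) + 1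

/-- Run a circuit, then another one that may depend on its classical output. -/
def Circuit.andThen {W : Type} [DecidableEq W] {d : W → ℕ} {α β : Type} :
    Circuit d α → (α → Circuit d β) → Circuit d β
  | .halt a, D => D a
  | .layer L next, D => .layer L (next.andThen D)
  | .measure S next, D => .measure S fun o => (next o).andThen D

/-- Probability that a circuit started in the normalized state `χ` outputs `a` (Born rule). -/
noncomputable def Circuit.prob {W : Type} [Fintype W] [DecidableEq W] {d : W → ℕ} {α : Type}
    [DecidableEq α] : Circuit d α → Ket (Config d) → α → ℝ
  | .halt a', χ, a => if a' = a then ketNormSq χ else 0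
  | .layer L next, χ, a => next.prob (L.apply χ) a
  | .measure S next, χ, a => ∑ o, (next o).prob (collapse S o χ) a

/-- `R a χ'` holds on each branch of the circuit started in `χ`, where `a` is the classical
output and `χ'` the unnormalized final state of that branch. -/
def Circuit.OnBranches {W : Type} [DecidableEq W] {d : W → ℕ} {α : Type} :
    Circuit d α → Ket (Config d) → (α → Ket (Config d) → Prop) → Prop
  | .halt a, χ, R => R a χ
  | .layer L next, χ, R => next.OnBranches (L.apply χ) R
  | .measure S next, χ, R => ∀ o, (next o).OnBranches (collapse S o χ) R

/-! ### Circuits on `ℓ` register qubits, `b` further ancilla qubits and `n` spin-`s` qudits -/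

/-- The wires: register qubits, auxiliary qubits, system qudits. -/
abbrev Wire (ℓ b n : ℕ) : Type := Fin ℓ ⊕ (Fin b ⊕ Fin n)

/-- Dimension of each wire: `2` for all ancillas, `2s + 1` for the system qudits. -/
abbrev wireDim (t ℓ b n : ℕ) : Wire ℓ b n → ℕ :=
  Sum.elim (fun _ => 2) (Sum.elim (fun _ => 2) (fun _ => t + 1))

/-- The register part of a basis label. -/
def regPart {t ℓ b n : ℕ} (x : Config (wireDim t ℓ b n)) : RegConfig ℓ :=
  fun j => x (Sum.inl j)

/-- The auxiliary part of a basis label. -/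
def auxPart {t ℓ b n : ℕ} (x : Config (wireDim t ℓ b n)) : Fin b → Fin 2 :=
  fun i => x (Sum.inr (Sum.inl i))

/-- The system part of a basis label. -/
def sysPart {t ℓ b n : ℕ} (x : Config (wireDim t ℓ b n)) : SysConfig t n :=
  fun i => x (Sum.inr (Sum.inr i))

/-- The joint state with system and register in the state `f` and auxiliary qubits in `|a⟩`. -/
def joint {t ℓ b n : ℕ} (f : Ket (SysConfig t n × RegConfig ℓ)) (a : Fin b → Fin 2) :
    Ket (Config (wireDim t ℓ b n)) :=
  fun x => if auxPart x = a then f (sysPart x, regPart x) else 0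

/-- System in the state `φ`, all ancilla qubits in `|0⟩`. -/
def startKet {t : ℕ} (ℓ b : ℕ) {n : ℕ} (φ : Ket (SysConfig t n)) :
    Ket (Config (wireDim t ℓ b n)) :=
  joint (ketTensor φ (basisKet (fun _ => 0))) (fun _ => 0)

/-- The circuit `Q` realizes, exactly and on every input, the standard phase estimation circuit
for `U` (up to the measurement of the register): on each branch the system and the register end
in the phase estimation state, in a product with a basis state of the auxiliary qubits. -/
def RealizesQPE {t ℓ b n : ℕ} (Q : Circuit (wireDim t ℓ b n) Unit)
    (U : Matrix (SysConfig t n) (SysConfig t n) ℂ) : Prop :=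
  ∀ φ : Ket (SysConfig t n), Q.OnBranches (startKet ℓ b φ) fun _ χ =>
    ∃ (z : ℂ) (a : Fin b → Fin 2), χ = z • joint (qpe ℓ U φ) a

/-- Measure all register qubits and output the integer that is read. -/
def measureRegister (t ℓ b n : ℕ) : Circuit (wireDim t ℓ b n) ℕ :=
  .measure (Finset.univ.map ⟨Sum.inl, Sum.inl_injective⟩) fun o =>
    .halt (regVal (ℓ := ℓ) fun j => o ⟨Sum.inl j, by simp⟩)

/-- One preparation attempt: the layer `prep`, the circuit `Q`, the register measurement. -/
def attempt {t ℓ b n : ℕ} (prep : Layer (wireDim t ℓ b n))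
    (Q : Circuit (wireDim t ℓ b n) Unit) : Circuit (wireDim t ℓ b n) ℕ :=
  .layer prep (Q.andThen fun _ => measureRegister t ℓ b n)

/-! The operator `K` is diagonal, with eigenvalue `levelSum x`, an integer between `0` and `t * n <
2 ^ ℓ`. Its phases are therefore exact `ℓ`-bit fractions, and phase estimation writes `levelSum x`
into the register without error (`qpe_phaseU_apply`). Each application of the lowering operator
distributes over the sites, so `(S⁻)^k |0…0⟩` has amplitude `k! ∏ √(binom t (x i))` on the labels
with `levelSum x = k` (`rawDicke_eq`), and Vandermonde's identity gives its norm. The amplitudes of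
the product state contain the same product times a factor depending only on `levelSum x`; hence the
product state is the superposition of Dicke states with weights `√P(j)`, and reading `k` projects
onto the Dicke state with probability `P(k)`. Since `k` is the mean of the binomial distribution,
Stirling's bounds give `P(k) ≥ 1 / (2 √(t n))` (`sqrt_le_successP`).

It remains to realize phase estimation with `O(ℓ)` layers and `n` further qubits. All controlled
powers of `U` are products of diagonal two-wire phases between a register bit and a qudit. A tree of
controlled-nots copies the register bits in at most `ℓ` doublings, so that blocks of `ℓ` qudits each
own a copy of the register; within a block the qudits use the `ℓ` bits in cyclic rotation, which
takes `ℓ` layers, and the copies are then undone (`kickLayers_apply`). The powers are assigned to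
the bits in reversed order, so that the inverse Fourier transform needs no final swaps.

In the inverse Fourier transform, the phase between bits `a < b` has to be applied after the
Hadamard gate on `a` and before the one on `b`. Executing it at time `a + b`, with the Hadamard gate
on `j` between times `2 j` and `2 j + 1`, satisfies this, since `2 a < a + b < 2 b`; pairs with
equal sum are disjoint, so `3 ℓ` layers suffice. The invariant of this schedule is `qftState`, and
its induction step is `qftStep_apply`. The circuit contains no measurement and thus has a single
branch. -/

/-! ### Exact phase estimation for the level operator -/

/-- The total level `∑ i, x i` of a basis label. -/
def levelSum {t n : ℕ} (x : SysConfig t n) : ℕ := ∑ i, (x i : ℕ)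

theorem levelSum_le {t n : ℕ} (x : SysConfig t n) : levelSum x ≤ t * n := by
  calc levelSum x ≤ ∑ _i : Fin n, t := Finset.sum_le_sum fun i _ => Nat.lt_succ_iff.mp (x i).2
    _ = t * n := by simp [mul_comm]

theorem totalLevelOp_eq_diagonal (t n : ℕ) :
    totalLevelOp t n = Matrix.diagonal fun x => (levelSum x : ℂ) := by
  ext x y
  simp only [totalLevelOp, Matrix.sum_apply, siteOp, levelOp, Matrix.diagonal_apply]
  by_cases h : x = y
  · subst h; simp [levelSum]
  · rw [if_neg h]
    refine Finset.sum_eq_zero fun i _ => ?_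
    split_ifs with h1 h2
    · exact absurd (funext fun j => if hj : j = i then hj ▸ h2 else h1 j hj) h
    · rfl
    · rfl

theorem phaseU_pow_eq_diagonal (t n ℓ r : ℕ) :
    phaseU t n ℓ ^ r = Matrix.diagonal fun x : SysConfig t n =>
      Complex.exp (2 * (Real.pi : ℂ) * Complex.I * ((r : ℂ) * levelSum x / 2 ^ ℓ)) := by
  rw [phaseU, totalLevelOp_eq_diagonal, ← Matrix.diagonal_smul, Matrix.exp_diagonal,
    Matrix.diagonal_pow]
  congr 1
  ext x
  rw [Pi.pow_apply, Pi.coe_exp, ← Complex.exp_eq_exp_ℂ, ← Complex.exp_nat_mul]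
  congr 1
  simp
  ring

/-- `regVal` is by definition the value of `finFunctionFinEquiv` in base `2`, so range, injectivity
and reindexing of sums are inherited from that equivalence. -/
theorem regVal_lt {ℓ : ℕ} (x : RegConfig ℓ) : regVal x < 2 ^ ℓ :=
  (finFunctionFinEquiv x).2

theorem regVal_eq {ℓ : ℕ} (x : RegConfig ℓ) : regVal x = (finFunctionFinEquiv x : ℕ) := rfl

theorem regVal_injective {ℓ : ℕ} : Function.Injective (regVal : RegConfig ℓ → ℕ) := fun _ _ h =>
  finFunctionFinEquiv.injective (Fin.ext h)

theorem sum_regVal {ℓ : ℕ} (f : ℕ → ℂ) :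
    ∑ r : RegConfig ℓ, f (regVal r) = ∑ i ∈ Finset.range (2 ^ ℓ), f i := by
  rw [Finset.sum_range]
  exact Equiv.sum_comp finFunctionFinEquiv (fun i => f i)

theorem controlledOp_diagonal_mulVec {X : Type} [Fintype X] [DecidableEq X] {ℓ : ℕ} (j : Fin ℓ)
    (u : X → ℂ) (χ : Ket (X × RegConfig ℓ)) (z : X × RegConfig ℓ) :
    (controlledOp j (Matrix.diagonal u)).mulVec χ z = (if z.2 j = 1 then u z.1 else 1) * χ z := by
  obtain ⟨x, r⟩ := z
  have : controlledOp j (Matrix.diagonal u) =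
      Matrix.diagonal fun z : X × RegConfig ℓ => if z.2 j = 1 then u z.1 else 1 := by
    ext ⟨x, r⟩ ⟨y, q⟩
    simp only [controlledOp, Matrix.blockDiagonal_apply, Matrix.diagonal_apply, Prod.mk.injEq]
    by_cases hr : r = q <;> by_cases hx : x = y <;> by_cases h1 : r j = 1 <;>
      simp_all [Matrix.one_apply]
  rw [this, Matrix.mulVec_diagonal]

theorem foldl_controlledOp_diagonal {X : Type} [Fintype X] [DecidableEq X] {ℓ : ℕ}
    (u : Fin ℓ → X → ℂ) (M : Fin ℓ → Matrix X X ℂ) (hM : ∀ j, M j = Matrix.diagonal (u j))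
    (l : List (Fin ℓ)) (χ : Ket (X × RegConfig ℓ)) (z : X × RegConfig ℓ) :
    l.foldl (fun χ j => (controlledOp j (M j)).mulVec χ) χ z =
      (l.map fun j => if z.2 j = 1 then u j z.1 else 1).prod * χ z := by
  induction l generalizing χ with
  | nil => simp
  | cons j l ih =>
    rw [List.foldl_cons, ih, hM, controlledOp_diagonal_mulVec]
    simp only [List.map_cons, List.prod_cons]
    ring

theorem one_kronecker_mulVec {X Y : Type} [Fintype X] [DecidableEq X] [Fintype Y]
    (A : Matrix Y Y ℂ) (χ : Ket (X × Y)) (z : X × Y) :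
    (Matrix.kronecker (1 : Matrix X X ℂ) A).mulVec χ z = ∑ y, A z.2 y * χ (z.1, y) := by
  rw [Matrix.mulVec, dotProduct, Fintype.sum_prod_type]
  change ∑ x, ∑ y, ((1 : Matrix X X ℂ) z.1 x * A z.2 y) * χ (x, y) = _
  simp only [Matrix.one_apply]
  rw [Finset.sum_eq_single z.1]
  · simp
  · intro x _ hx; simp [hx.symm]
  · simp

/-- Orthogonality of the characters modulo `N`: for `a ≠ b` the geometric ratio differs from `1`
because `N` cannot divide `a - b` when `|a - b| < N`. -/
theorem sum_exp_two_pi_mul_div (N : ℕ) (hN : N ≠ 0) (a b : ℕ) (ha : a < N) (hb : b < N) :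
    ∑ i ∈ Finset.range N,
      Complex.exp (2 * (Real.pi : ℂ) * Complex.I * (((a : ℂ) - b) * i / N)) =
      if a = b then (N : ℂ) else 0 := by
  have hN' : (N : ℂ) ≠ 0 := Nat.cast_ne_zero.mpr hN
  have key : ∀ i : ℕ, Complex.exp (2 * (Real.pi : ℂ) * Complex.I * (((a : ℂ) - b) * i / N)) =
      Complex.exp (2 * (Real.pi : ℂ) * Complex.I * (((a : ℂ) - b) / N)) ^ i := fun i => by
    rw [← Complex.exp_nat_mul]; congr 1; ring
  simp only [key]
  split_ifs with h
  · subst h; simp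
  · have hne : Complex.exp (2 * (Real.pi : ℂ) * Complex.I * (((a : ℂ) - b) / N)) ≠ 1 := by
      intro h1
      obtain ⟨m, hm⟩ := Complex.exp_eq_one_iff.mp h1
      have h2 : ((a : ℂ) - b) = m * N := by
        have h3 : (2 * (Real.pi : ℂ) * Complex.I) ≠ 0 := Complex.two_pi_I_ne_zero
        rw [mul_comm (m : ℂ)] at hm
        have := mul_left_cancel₀ h3 hm
        rw [← this]; field_simp
      have h4 : (a : ℤ) - b = m * N := by exact_mod_cast h2
      have h5 : (N : ℤ) ∣ (a : ℤ) - b := ⟨m, by rw [h4]; ring⟩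
      have h6 := Int.eq_zero_of_abs_lt_dvd h5 (by rw [abs_lt]; omega)
      omega
    rw [geom_sum_eq hne, ← Complex.exp_nat_mul]
    have : (N : ℂ) * (2 * (Real.pi : ℂ) * Complex.I * (((a : ℂ) - b) / N)) =
        ((a - b : ℤ) : ℂ) * (2 * (Real.pi : ℂ) * Complex.I) := by
      push_cast; field_simp
    rw [this, Complex.exp_int_mul_two_pi_mul_I]
    simp

/-- Phase estimation of `exp (2 π i K / 2 ^ ℓ)` writes the eigenvalue of `K` in the register. -/
theorem qpe_phaseU_apply {t n ℓ : ℕ} (h : t * n < 2 ^ ℓ) (φ : Ket (SysConfig t n))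
    (z : SysConfig t n × RegConfig ℓ) :
    qpe ℓ (phaseU t n ℓ) φ z = if regVal z.2 = levelSum z.1 then φ z.1 else 0 := by
  obtain ⟨x, r⟩ := z
  have hH : ∀ q : RegConfig ℓ, (Matrix.kronecker (1 : Matrix (SysConfig t n) (SysConfig t n) ℂ)
      (hadamardAll ℓ)).mulVec (ketTensor φ (basisKet (fun _ => 0))) (x, q) =
      (((Real.sqrt (2 ^ ℓ))⁻¹ : ℝ) : ℂ) * φ x := by
    intro q
    rw [one_kronecker_mulVec, Finset.sum_eq_single (fun _ => 0)]
    · have : Real.sqrt (2 ^ ℓ) = Real.sqrt 2 ^ ℓ := by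
        rw [Real.sqrt_eq_iff_mul_self_eq (by positivity) (by positivity), ← mul_pow]
        simp
      simp [hadamardAll, ketTensor, basisKet, this]
    · intro y _ hy
      simp [ketTensor, basisKet, hy]
    · simp
  -- The controlled powers `2 ^ j` compose according to the binary digits of `q`, so together they
  -- act as `U ^ q`.
  have hP : ∀ q : RegConfig ℓ, ((List.finRange ℓ).map fun j => if q j = 1 then
      Complex.exp (2 * (Real.pi : ℂ) * Complex.I * (((2 ^ (j : ℕ) : ℕ) : ℂ) * levelSum x / 2 ^ ℓ))
      else 1).prod = Complex.exp (2 * (Real.pi : ℂ) * Complex.I *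
        (levelSum x * (regVal q : ℂ) / 2 ^ ℓ)) := by
    intro q
    rw [← List.ofFn_eq_map, List.prod_ofFn, regVal]
    push_cast
    rw [Finset.mul_sum, Finset.sum_div, Finset.mul_sum, Complex.exp_sum]
    refine Finset.prod_congr rfl fun j _ => ?_
    rcases Fin.exists_fin_two.mp ⟨q j, rfl⟩ with h0 | h0 <;> rw [h0] <;> simp
    congr 1; ring
  rw [qpe, one_kronecker_mulVec]
  simp only [foldl_controlledOp_diagonal _ _
    (fun j : Fin ℓ => phaseU_pow_eq_diagonal t n ℓ (2 ^ (j : ℕ))), hH, hP]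
  -- Each term is rewritten as a character at `levelSum x - regVal r`, ready for the orthogonality
  -- relation.
  have key : ∀ q : RegConfig ℓ, (qft ℓ).conjTranspose r q *
      (Complex.exp (2 * (Real.pi : ℂ) * Complex.I * (levelSum x * (regVal q : ℂ) / 2 ^ ℓ)) *
        ((((Real.sqrt (2 ^ ℓ))⁻¹ : ℝ) : ℂ) * φ x)) = ((2 : ℂ) ^ ℓ)⁻¹ * φ x *
      Complex.exp (2 * (Real.pi : ℂ) * Complex.I *
        (((levelSum x : ℂ) - regVal r) * (regVal q : ℂ) / ((2 ^ ℓ : ℕ) : ℂ))) := by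
    intro q
    have h2 : ((((Real.sqrt (2 ^ ℓ))⁻¹ : ℝ) : ℂ)) * (((Real.sqrt (2 ^ ℓ))⁻¹ : ℝ) : ℂ) =
        ((2 : ℂ) ^ ℓ)⁻¹ := by
      rw [← Complex.ofReal_mul, ← mul_inv, Real.mul_self_sqrt (by positivity)]
      push_cast; rfl
    have h3 : (starRingEnd ℂ) (Complex.exp (2 * (Real.pi : ℂ) * Complex.I * (regVal q : ℂ) *
        (regVal r : ℂ) / 2 ^ ℓ)) = Complex.exp (-(2 * (Real.pi : ℂ) * Complex.I *
        (regVal q : ℂ) * (regVal r : ℂ) / 2 ^ ℓ)) := by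
      rw [← Complex.exp_conj]; congr 1; simp [neg_div, Complex.conj_ofNat]
    rw [Matrix.conjTranspose_apply, qft, star_mul', ← starRingEnd_apply, ← starRingEnd_apply, h3,
      Complex.conj_ofReal]
    rw [← h2]
    have h4 : Complex.exp (2 * (Real.pi : ℂ) * Complex.I *
        (((levelSum x : ℂ) - regVal r) * (regVal q : ℂ) / ((2 ^ ℓ : ℕ) : ℂ))) =
        Complex.exp (-(2 * (Real.pi : ℂ) * Complex.I *
        (regVal q : ℂ) * (regVal r : ℂ) / 2 ^ ℓ)) *
        Complex.exp (2 * (Real.pi : ℂ) * Complex.I * (levelSum x * (regVal q : ℂ) / 2 ^ ℓ)) := by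
      rw [← Complex.exp_add]; congr 1; push_cast; ring
    rw [h4]; ring
  simp only [key]
  rw [← Finset.mul_sum, sum_regVal (fun i => Complex.exp (2 * (Real.pi : ℂ) * Complex.I *
        (((levelSum x : ℂ) - regVal r) * (i : ℂ) / ((2 ^ ℓ : ℕ) : ℂ)))),
    sum_exp_two_pi_mul_div _ (by positivity) _ _ ((levelSum_le x).trans_lt h) (regVal_lt r)]
  by_cases h5 : regVal r = levelSum x
  · simp [h5]
    field_simp
  · simp [h5, Ne.symm h5]

/-! ### Amplitudes of Dicke states and of the product state -/

/-- The product `∏ i, √(binom (2s) (x i))`. -/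
noncomputable def sqrtChooseProd {t n : ℕ} (x : SysConfig t n) : ℝ :=
  ∏ i, Real.sqrt (t.choose (x i))

theorem siteOp_mulVec {X : Type} [Fintype X] [DecidableEq X] {n : ℕ} (i : Fin n)
    (A : Matrix X X ℂ) (χ : Ket (Fin n → X)) (x : Fin n → X) :
    (siteOp i A).mulVec χ x = ∑ m, A (x i) m * χ (Function.update x i m) := by
  rw [Matrix.mulVec, dotProduct]
  symm
  refine Finset.sum_of_injOn (fun m => Function.update x i m)
    (fun a _ b _ h => by simpa using congrFun h i) (by simp) ?_ ?_
  · intro y _ hy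
    rw [siteOp, if_neg, zero_mul]
    intro h
    refine hy ⟨y i, by simp, ?_⟩
    ext j
    by_cases hj : j = i
    · subst hj; simp
    · simp [hj, h j hj]
  · intro m _
    rw [siteOp, if_pos]
    · simp
    · intro j hj; simp [hj]

theorem levelSum_update {t n : ℕ} (x : SysConfig t n) (i : Fin n) (m : Fin (t + 1)) :
    levelSum (Function.update x i m) + x i = levelSum x + m := by
  rw [levelSum, levelSum, ← Finset.add_sum_erase _ _ (Finset.mem_univ i),
    ← Finset.add_sum_erase (a := i) Finset.univ (fun j => (x j : ℕ)) (Finset.mem_univ i)]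
  rw [Finset.sum_congr rfl (g := fun j => (x j : ℕ))]
  · simp; ring
  · intro j hj
    simp [Finset.ne_of_mem_erase hj]

/-- This is the square root of `(m + 1) binom t (m + 1) = (t - m) binom t m`, multiplied by `m + 1`.
For `m > t` both binomials vanish, which makes the sign of `t - m` harmless. -/
theorem sqrt_mul_sqrt_choose (t m : ℕ) :
    Real.sqrt (((m : ℝ) + 1) * ((t : ℝ) - m)) * Real.sqrt (t.choose m) =
      (m + 1) * Real.sqrt (t.choose (m + 1)) := by
  have h : ((t.choose (m + 1) : ℝ)) * (m + 1) = t.choose m * ((t : ℝ) - m) := by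
    rcases le_or_gt m t with hm | hm
    · have := Nat.choose_succ_right_eq t m
      rw [← Nat.cast_sub hm]
      exact_mod_cast this
    · rw [Nat.choose_eq_zero_of_lt hm, Nat.choose_eq_zero_of_lt (by omega)]; simp
  rw [← Real.sqrt_mul' _ (by positivity), mul_assoc, mul_comm ((t : ℝ) - m), ← h,
    show ((m : ℝ) + 1) * (t.choose (m + 1) * (m + 1)) = (m + 1) ^ 2 * t.choose (m + 1) by ring,
    Real.sqrt_mul (by positivity), Real.sqrt_sq (by positivity)]

/-- Only the label with site `i` one level lower contributes. The resulting factor `x i`, summed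
over all sites, becomes `levelSum x = k + 1`; this is the source of the factorial in `rawDicke_eq`.
-/
theorem siteOp_lowering_mulVec {t n : ℕ} (i : Fin n) (k : ℕ) (x : SysConfig t n) :
    (siteOp i (lowering t)).mulVec
      (fun x => if levelSum x = k then (sqrtChooseProd x : ℂ) else 0) x =
      if levelSum x = k + 1 then (x i : ℂ) * sqrtChooseProd x else 0 := by
  rw [siteOp_mulVec]
  by_cases h0 : (x i : ℕ) = 0
  · rw [Finset.sum_eq_zero]
    · simp [h0]
    · intro m _
      rw [lowering, if_neg (by omega), zero_mul]
  · obtain ⟨a, ha⟩ := Nat.exists_eq_succ_of_ne_zero h0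
    have hat : a < t + 1 := by have := (x i).2; omega
    rw [Finset.sum_eq_single ⟨a, hat⟩]
    · have h1 := levelSum_update x i ⟨a, hat⟩
      simp only at h1
      have h2 : levelSum (Function.update x i ⟨a, hat⟩) = k ↔ levelSum x = k + 1 := by omega
      simp only [h2, mul_ite, mul_zero]
      refine if_congr Iff.rfl ?_ rfl
      rw [lowering, if_pos ha]
      have h3 : sqrtChooseProd (Function.update x i ⟨a, hat⟩) =
          Real.sqrt (t.choose a) * ∏ j ∈ Finset.univ.erase i, Real.sqrt (t.choose (x j)) := by
        rw [sqrtChooseProd, ← Finset.mul_prod_erase _ _ (Finset.mem_univ i)]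
        congr 1
        · simp
        · exact Finset.prod_congr rfl fun j hj => by simp [Finset.ne_of_mem_erase hj]
      have h4 : sqrtChooseProd x = Real.sqrt (t.choose (a + 1)) *
          ∏ j ∈ Finset.univ.erase i, Real.sqrt (t.choose (x j)) := by
        rw [sqrtChooseProd, ← Finset.mul_prod_erase _ _ (Finset.mem_univ i), ha]
      rw [h3, h4, ha, ← Complex.ofReal_mul, ← mul_assoc, sqrt_mul_sqrt_choose]
      push_cast; ring
    · intro m _ hm
      rw [lowering, if_neg, zero_mul]
      intro h
      exact hm (Fin.ext (by simp; omega))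
    · simp

/-- The amplitudes of the unnormalized Dicke state. -/
theorem rawDicke_eq (t n k : ℕ) :
    rawDicke t n k = (k.factorial : ℂ) •
      fun x => if levelSum x = k then (sqrtChooseProd x : ℂ) else 0 := by
  induction k with
  | zero =>
    ext x
    have h : levelSum x = 0 ↔ x = fun _ => 0 := by
      simp [levelSum, funext_iff]
    by_cases hx : x = fun _ => 0
    · subst hx
      simp [rawDicke, basisKet, levelSum, sqrtChooseProd]
    · simp [rawDicke, basisKet, h, hx]
  | succ k ih =>
    have h : rawDicke t n (k + 1) = (totalLowering t n).mulVec (rawDicke t n k) := by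
      rw [rawDicke, pow_succ', ← Matrix.mulVec_mulVec]; rfl
    rw [h, ih, Matrix.mulVec_smul, totalLowering, Matrix.sum_mulVec]
    ext x
    simp only [Pi.smul_apply, Finset.sum_apply, siteOp_lowering_mulVec]
    by_cases hk : levelSum x = k + 1
    · simp only [hk, if_true, ← Finset.sum_mul]
      have : (∑ i, ((x i : ℕ) : ℂ)) = k + 1 := by
        rw [← Nat.cast_sum]; exact_mod_cast hk
      rw [this, Nat.factorial_succ]
      simp only [smul_eq_mul]
      push_cast; ring
    · simp [hk]

theorem sqrtChooseProd_sq {t n : ℕ} (x : SysConfig t n) :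
    sqrtChooseProd x ^ 2 = ((∏ i, t.choose (x i) : ℕ) : ℝ) := by
  rw [sqrtChooseProd, ← Finset.prod_pow]
  push_cast
  exact Finset.prod_congr rfl fun i _ => Real.sq_sqrt (by positivity)

/-- The generalized Vandermonde identity. -/
theorem sum_prod_choose (t n k : ℕ) :
    ∑ x : SysConfig t n, (if levelSum x = k then ∏ i, t.choose (x i) else 0) =
      (t * n).choose k := by
  -- Both sides of the identity are the coefficient of `X ^ k` in `((1 + X) ^ t) ^ n`.
  have h : ((1 + Polynomial.X : Polynomial ℕ) ^ t) =
      ∑ m : Fin (t + 1), Polynomial.C (t.choose m) * Polynomial.X ^ (m : ℕ) := by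
    rw [add_comm, add_pow, ← Fin.sum_univ_eq_sum_range]
    refine Finset.sum_congr rfl fun m _ => ?_
    simp [mul_comm]
  rw [← Nat.cast_id ((t * n).choose k), ← Polynomial.coeff_one_add_X_pow ℕ (t * n) k, pow_mul, h,
    ← Fin.prod_const, Finset.prod_univ_sum, Polynomial.finsetSum_coeff]
  rw [Fintype.piFinset_univ]
  refine Finset.sum_congr rfl fun x _ => ?_
  rw [Finset.prod_mul_distrib, Finset.prod_pow_eq_pow_sum, ← map_prod, Polynomial.coeff_C_mul,
    Polynomial.coeff_X_pow]
  simp [levelSum, eq_comm]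

theorem sum_levelSum_sqrtChooseProd_sq (t n k : ℕ) :
    ∑ x : SysConfig t n, (if levelSum x = k then sqrtChooseProd x ^ 2 else 0) =
      ((t * n).choose k : ℝ) := by
  rw [← sum_prod_choose t n k]
  push_cast
  exact Finset.sum_congr rfl fun x _ => by rw [sqrtChooseProd_sq]; push_cast; rfl

theorem ketNormSq_rawDicke (t n k : ℕ) :
    ketNormSq (rawDicke t n k) = (k.factorial : ℝ) ^ 2 * ((t * n).choose k : ℝ) := by
  rw [ketNormSq, rawDicke_eq, ← sum_levelSum_sqrtChooseProd_sq, Finset.mul_sum]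
  refine Finset.sum_congr rfl fun x _ => ?_
  by_cases h : levelSum x = k
  · simp [h, mul_pow]
  · simp [h]

/-- The amplitudes of the Dicke state. -/
theorem dicke_apply (t n k : ℕ) (x : SysConfig t n) :
    dicke t n k x = if levelSum x = k then
      ((sqrtChooseProd x / Real.sqrt ((t * n).choose k) : ℝ) : ℂ) else 0 := by
  rw [dicke, ketNormSq_rawDicke, rawDicke_eq, Real.sqrt_mul (by positivity),
    Real.sqrt_sq (by positivity)]
  by_cases h : levelSum x = k
  · have : (k.factorial : ℂ) ≠ 0 := by exact_mod_cast k.factorial_ne_zero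
    simp [h]
    field_simp
  · simp [h]

theorem ketNormSq_dicke {t n k : ℕ} (hk : k ≤ t * n) : ketNormSq (dicke t n k) = 1 := by
  have h0 : (0 : ℝ) < (t * n).choose k := by exact_mod_cast Nat.choose_pos hk
  have : ∀ x : SysConfig t n, ‖dicke t n k x‖ ^ 2 =
      (if levelSum x = k then sqrtChooseProd x ^ 2 else 0) / ((t * n).choose k : ℝ) := by
    intro x
    rw [dicke_apply]
    split_ifs
    · rw [Complex.norm_real, Real.norm_eq_abs, sq_abs, div_pow, Real.sq_sqrt h0.le]
    · simp
  rw [ketNormSq, Finset.sum_congr rfl fun x _ => this x, ← Finset.sum_div,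
    sum_levelSum_sqrtChooseProd_sq, div_self h0.ne']

theorem ketPow_psi_apply (t n : ℕ) (p : ℝ) (x : SysConfig t n) :
    ketPow n (psi t p) x = ((Real.sqrt (1 - p) ^ (t * n - levelSum x) *
      Real.sqrt p ^ levelSum x * sqrtChooseProd x : ℝ) : ℂ) := by
  simp only [ketPow, psi]
  rw [← Complex.ofReal_prod, Finset.prod_mul_distrib, Finset.prod_mul_distrib,
    Finset.prod_pow_eq_pow_sum, Finset.prod_pow_eq_pow_sum]
  have : ∑ i, (t - (x i : ℕ)) = t * n - levelSum x := by
    rw [Finset.sum_tsub_distrib _ fun i _ => Nat.lt_succ_iff.mp (x i).2]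
    simp [levelSum, mul_comm]
  rw [this]; rfl

theorem sqrt_pow_eq {x : ℝ} (hx : 0 ≤ x) (k : ℕ) : Real.sqrt (x ^ k) = Real.sqrt x ^ k := by
  rw [Real.sqrt_eq_iff_mul_self_eq (by positivity) (by positivity), ← mul_pow,
    Real.mul_self_sqrt hx]

/-- The amplitudes of the tensor power are those of the superposition of Dicke states. -/
theorem ketPow_psi_apply_eq_dicke {t n : ℕ} {p : ℝ} (hp0 : 0 ≤ p) (hp1 : p ≤ 1)
    (x : SysConfig t n) :
    ketPow n (psi t p) x =
      ((Real.sqrt (successP t n p (levelSum x)) : ℝ) : ℂ) * dicke t n (levelSum x) x := by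
  have h0 : (0 : ℝ) < (t * n).choose (levelSum x) := by
    exact_mod_cast Nat.choose_pos (levelSum_le x)
  have hp2 : 0 ≤ 1 - p := by linarith
  rw [ketPow_psi_apply, dicke_apply, if_pos rfl, ← Complex.ofReal_mul, successP,
    Real.sqrt_mul (by positivity), Real.sqrt_mul (by positivity), sqrt_pow_eq hp0,
    sqrt_pow_eq hp2]
  congr 1
  have := Real.sqrt_pos.mpr h0
  field_simp

/-- Phase estimation on the product state. -/
theorem qpe_ketPow_psi {t n ℓ : ℕ} (hℓ : t * n < 2 ^ ℓ) {p : ℝ} (hp0 : 0 ≤ p) (hp1 : p ≤ 1) :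
    qpe ℓ (phaseU t n ℓ) (ketPow n (psi t p)) =
      ∑ j ∈ Finset.range (t * n + 1), ((Real.sqrt (successP t n p j) : ℝ) : ℂ) •
        ketTensor (dicke t n j) (regKet ℓ j) := by
  ext ⟨x, r⟩
  rw [qpe_phaseU_apply hℓ, Finset.sum_apply, Finset.sum_eq_single (levelSum x)]
  · simp only [Pi.smul_apply, smul_eq_mul, ketTensor, regKet]
    split_ifs
    · rw [ketPow_psi_apply_eq_dicke hp0 hp1, mul_one]
    · simp
  · intro j _ hj
    simp [ketTensor, dicke_apply, hj.symm]
  · intro h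
    exact absurd (Finset.mem_range.mpr (Nat.lt_succ_of_le (levelSum_le x))) h

theorem ketNormSq_psi (t : ℕ) {p : ℝ} (hp0 : 0 ≤ p) (hp1 : p ≤ 1) : ketNormSq (psi t p) = 1 := by
  have hp2 : 0 ≤ 1 - p := by linarith
  have : ∀ m : Fin (t + 1), ‖psi t p m‖ ^ 2 =
      p ^ (m : ℕ) * (1 - p) ^ (t - (m : ℕ)) * t.choose m := by
    intro m
    rw [psi, Complex.norm_real, Real.norm_eq_abs, sq_abs, mul_pow, mul_pow, ← pow_mul, ← pow_mul,
      mul_comm _ 2, mul_comm _ 2, pow_mul, pow_mul, Real.sq_sqrt hp0, Real.sq_sqrt hp2,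
      Real.sq_sqrt (by positivity)]
    ring
  rw [ketNormSq, Finset.sum_congr rfl fun m _ => this m,
    Fin.sum_univ_eq_sum_range (fun m => p ^ m * (1 - p) ^ (t - m) * (t.choose m : ℝ)), ← add_pow]
  simp

/-! ### The binomial weight at the mean -/

/-- The Stirling sequence decreases from its value `e / √2` at `1`. -/
theorem factorial_le_exp_mul_sqrt {k : ℕ} (hk : k ≠ 0) :
    (k.factorial : ℝ) ≤ Real.exp 1 * Real.sqrt k * (k / Real.exp 1) ^ k := by
  have hk' : (0 : ℝ) < k := by exact_mod_cast Nat.pos_of_ne_zero hk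
  obtain ⟨m, rfl⟩ := Nat.exists_eq_succ_of_ne_zero hk
  have h := Stirling.stirlingSeq'_antitone (Nat.zero_le m)
  simp only [Function.comp_apply, Nat.succ_eq_add_one, zero_add, Stirling.stirlingSeq_one] at h
  rw [Stirling.stirlingSeq, div_le_iff₀ (by positivity), Real.sqrt_mul (by norm_num)] at h
  refine h.trans (le_of_eq ?_)
  have : Real.sqrt 2 ≠ 0 := by positivity
  field_simp

theorem successP_pos {t n k : ℕ} {p : ℝ} (hk : k ≤ t * n) (hN : 0 < t * n)
    (hp : p = (k : ℝ) / ((t * n : ℕ) : ℝ)) : 0 < successP t n p k := by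
  have hN' : (0 : ℝ) < ((t * n : ℕ) : ℝ) := by exact_mod_cast hN
  have h0 : (0 : ℝ) < (t * n).choose k := by exact_mod_cast Nat.choose_pos hk
  have h1 : 0 < p ^ k := by
    rcases Nat.eq_zero_or_pos k with h | h
    · simp [h]
    · have : (0 : ℝ) < k := by exact_mod_cast h
      rw [hp]; positivity
  have h2 : 0 < (1 - p) ^ (t * n - k) := by
    rcases hk.eq_or_lt with h | h
    · simp [h]
    · have : p < 1 := by rw [hp, div_lt_one hN']; exact_mod_cast h
      exact pow_pos (by linarith) _
  rw [successP]; positivity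

theorem successP_le_one {t n k : ℕ} {p : ℝ} (hk : k ≤ t * n) (hp0 : 0 ≤ p) (hp1 : p ≤ 1) :
    successP t n p k ≤ 1 := by
  have hp2 : 0 ≤ 1 - p := by linarith
  have h := add_pow p (1 - p) (t * n)
  simp only [add_sub_cancel, one_pow] at h
  rw [h, successP]
  refine le_trans (le_of_eq (by ring)) (Finset.single_le_sum
    (f := fun m => p ^ m * (1 - p) ^ (t * n - m) * ((t * n).choose m : ℝ))
    (fun i _ => by positivity) (Finset.mem_range.mpr (Nat.lt_succ_of_le hk)))

/-- A binomial distribution takes its mean value with probability at least `1 / (2 √N)`. -/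
theorem sqrt_le_successP {t n k : ℕ} {p : ℝ} (hk : k ≤ t * n) (hN : 0 < t * n)
    (hp : p = (k : ℝ) / ((t * n : ℕ) : ℝ)) :
    1 ≤ successP t n p k * (2 * Real.sqrt ((t * n : ℕ) : ℝ)) := by
  obtain ⟨m, hm⟩ := Nat.exists_eq_add_of_le hk
  set N := t * n with hNdef
  have hN1 : (1 : ℝ) ≤ N := by exact_mod_cast hN
  have hs1 : 1 ≤ Real.sqrt N := Real.one_le_sqrt.mpr hN1
  have hNr : (N : ℝ) = k + m := by rw [hm]; push_cast; rfl
  have hq : 1 - p = (m : ℝ) / N := by rw [hp]; field_simp; linarith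
  have hNk : N - k = m := by omega
  -- At the two ends the probability is `1`; they are separated because the upper factorial bound
  -- fails at `0`.
  rcases Nat.eq_zero_or_pos k with h0 | hk0
  · have : p = 0 := by rw [hp, h0]; simp
    rw [successP, this, h0]; simp; linarith
  rcases Nat.eq_zero_or_pos m with h0 | hm0
  · have hkN : k = N := by omega
    have : p = 1 := by rw [hp, hkN]; field_simp
    rw [successP, this, ← hNdef, hkN]; simp; linarith
  have hkr : (0 : ℝ) < k := by exact_mod_cast hk0
  have hmr : (0 : ℝ) < m := by exact_mod_cast hm0
  have hchoose : ((N.choose k : ℝ)) * k.factorial * m.factorial = N.factorial := by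
    rw [← hNk]; exact_mod_cast Nat.choose_mul_factorial_mul_factorial hk
  set a : ℝ := (k / Real.exp 1) ^ k * (m / Real.exp 1) ^ m with ha
  have ha0 : 0 < a := by positivity
  have hP : successP t n p k * (k.factorial * m.factorial) =
      N.factorial * (p ^ k * (1 - p) ^ m) := by
    rw [← hchoose, successP, ← hNdef, hNk]; ring
  have hlow : 2 * Real.sqrt N * a ≤ N.factorial * (p ^ k * (1 - p) ^ m) := by
    have h1 := Stirling.le_factorial_stirling N
    have h2 : 2 * Real.sqrt N ≤ Real.sqrt (2 * Real.pi * N) := by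
      rw [Real.le_sqrt (by positivity) (by positivity), mul_pow, Real.sq_sqrt (by positivity)]
      nlinarith [Real.pi_gt_three]
    -- With `p = k / N` and `1 - p = m / N` all powers of `N` cancel, and the main Stirling factors
    -- on the two sides agree exactly.
    have h3 : (N / Real.exp 1) ^ N * (p ^ k * (1 - p) ^ m) = a := by
      rw [hq, hp, ha]
      conv_lhs => rw [show ((N : ℝ) / Real.exp 1) ^ N =
        (N / Real.exp 1) ^ k * (N / Real.exp 1) ^ m by rw [← pow_add, ← hm]]
      rw [show ∀ a b c d : ℝ, a * b * (c * d) = (a * c) * (b * d) by intros; ring, ← mul_pow,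
        ← mul_pow]
      congr 2 <;> field_simp
    have hw : 0 ≤ p ^ k * (1 - p) ^ m := by rw [hq, hp]; positivity
    calc 2 * Real.sqrt N * a ≤ Real.sqrt (2 * Real.pi * N) * a := by gcongr
      _ = Real.sqrt (2 * Real.pi * N) * (N / Real.exp 1) ^ N * (p ^ k * (1 - p) ^ m) := by
        rw [← h3]; ring
      _ ≤ _ := by gcongr
  -- The constant `4` comes from `e ^ 2 ≤ 8` and `√k √m ≤ (k + m) / 2`. Against the lower bound `2
  -- √N a` this leaves `1 / (2 √N)`.
  have hup : (k.factorial : ℝ) * m.factorial ≤ 4 * N * a := by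
    have h1 := mul_le_mul (factorial_le_exp_mul_sqrt hk0.ne') (factorial_le_exp_mul_sqrt hm0.ne')
      (by positivity) (by positivity)
    refine h1.trans ?_
    have h2 : Real.exp 1 ^ 2 ≤ 8 := by
      have h3 := Real.exp_one_lt_d9
      have h4 := Real.exp_pos 1
      nlinarith
    have h3 : Real.sqrt k * Real.sqrt m ≤ N / 2 := by
      have := two_mul_le_add_sq (Real.sqrt k) (Real.sqrt m)
      rw [Real.sq_sqrt hkr.le, Real.sq_sqrt hmr.le] at this
      linarith
    calc _ = Real.exp 1 ^ 2 * (Real.sqrt k * Real.sqrt m) * a := by rw [ha]; ring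
      _ ≤ 8 * (N / 2) * a := by gcongr
      _ = 4 * N * a := by ring
  have hpos : 0 ≤ successP t n p k := (successP_pos hk hN hp).le
  have h5 : 2 * Real.sqrt N * a ≤ successP t n p k * (4 * N * a) := by
    calc _ ≤ _ := hlow
      _ = successP t n p k * (k.factorial * m.factorial) := hP.symm
      _ ≤ _ := by gcongr
  have h6 : Real.sqrt N * Real.sqrt N = N := Real.mul_self_sqrt (by positivity)
  have h7 : (2 * Real.sqrt N * a) * 1 ≤
      (2 * Real.sqrt N * a) * (successP t n p k * (2 * Real.sqrt N)) := by
    calc _ = 2 * Real.sqrt N * a := mul_one _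
      _ ≤ successP t n p k * (4 * N * a) := h5
      _ = successP t n p k * (4 * (Real.sqrt N * Real.sqrt N) * a) := by rw [h6]
      _ = _ := by ring
  exact le_of_mul_le_mul_left h7 (by positivity)

/-- The mean of a geometric distribution. -/
theorem hasSum_geometric_mean {q : ℝ} (h0 : 0 < q) (h1 : q ≤ 1) :
    HasSum (fun r : ℕ => ((r : ℝ) + 1) * ((1 - q) ^ r * q)) q⁻¹ := by
  have hr : ‖1 - q‖ < 1 := by rw [Real.norm_eq_abs, abs_lt]; constructor <;> linarith
  have h := ((hasSum_coe_mul_geometric_of_norm_lt_one hr).add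
    (hasSum_geometric_of_norm_lt_one hr)).mul_right q
  have e : ((1 - q) / (1 - (1 - q)) ^ 2 + (1 - (1 - q))⁻¹) * q = q⁻¹ := by
    rw [sub_sub_cancel]; field_simp; ring
  rw [e] at h
  refine h.congr_fun fun r => ?_
  ring

/-! ### Actions of gates and layers: phases, relabellings and product states -/

section Gates

variable {W : Type} {d : W → ℕ}

open Classical in
/-- Flip all wires `v i`, `i ∈ s`, whose control `u i` has the value `1`. -/
noncomputable def cnotMap {ι : Type} (s : Set ι) (u v : ι → W) (x : Config d) : Config d :=
  fun w => if ∃ i ∈ s, w = v i ∧ (x (u i) : ℕ) = 1 then (x w).rev else x w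

theorem cnotMap_of_ne {ι : Type} {s : Set ι} {u v : ι → W} (x : Config d) {w : W}
    (h : ∀ i ∈ s, w ≠ v i) : cnotMap s u v x w = x w := by
  rw [cnotMap, if_neg]
  rintro ⟨i, hi, hw, -⟩
  exact h i hi hw

/-- No control is a target, so the controls keep their values and the second application reverses
the same wires again. -/
theorem cnotMap_cnotMap {ι : Type} {s : Set ι} {u v : ι → W}
    (h : ∀ i ∈ s, ∀ j ∈ s, u i ≠ v j) (x : Config d) :
    cnotMap s u v (cnotMap s u v x) = x := by
  classical
  ext w
  have h1 : (∃ i ∈ s, w = v i ∧ (cnotMap s u v x (u i) : ℕ) = 1) ↔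
      ∃ i ∈ s, w = v i ∧ (x (u i) : ℕ) = 1 :=
    exists_congr fun i => and_congr_right fun hi => by rw [cnotMap_of_ne x (h i hi)]
  rw [cnotMap, if_congr h1 rfl rfl]
  by_cases h2 : ∃ i ∈ s, w = v i ∧ (x (u i) : ℕ) = 1
  · rw [if_pos h2, cnotMap, if_pos h2, Fin.rev_rev]
  · rw [if_neg h2, cnotMap, if_neg h2]

variable [DecidableEq W]

theorem overrideOn_localPart {S : Finset W} (x : Config d) :
    overrideOn x (localPart S x) = x := by
  ext w
  simp [overrideOn, localPart]

/-- The gate on the wires `u`, `v` that multiplies `|a⟩|b⟩` by `exp (2 π i θ(a, b))`. -/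
noncomputable def phaseGate (u v : W) (θ : ℕ → ℕ → ℝ) : Gate d where
  support := {u, v}
  card_le := Finset.card_le_two
  op := Matrix.diagonal fun y => Complex.exp
    (2 * (Real.pi : ℂ) * Complex.I * (θ (y ⟨u, by simp⟩) (y ⟨v, by simp⟩) : ℝ))
  unitary := by
    rw [Matrix.mem_unitaryGroup_iff, Matrix.star_eq_conjTranspose, Matrix.diagonal_conjTranspose,
      Matrix.diagonal_mul_diagonal, ← Matrix.diagonal_one]
    congr 1
    ext y
    rw [Pi.star_apply, ← starRingEnd_apply, ← Complex.exp_conj, ← Complex.exp_add]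
    simp [Complex.conj_ofNat]

theorem phaseGate_apply (u v : W) (θ : ℕ → ℕ → ℝ) (χ : Ket (Config d)) (x : Config d) :
    (phaseGate u v θ).apply χ x =
      Complex.exp (2 * (Real.pi : ℂ) * Complex.I * (θ (x u) (x v) : ℝ)) * χ x := by
  rw [Gate.apply, Finset.sum_eq_single (localPart _ x)]
  · rw [overrideOn_localPart]
    congr 1
    exact Matrix.diagonal_apply_eq _ _
  · intro y _ hy
    rw [show (phaseGate u v θ).op _ y = 0 from Matrix.diagonal_apply_ne _ hy.symm, zero_mul]
  · simp

/-- Flip the value of wire `v` if wire `u ≠ v` has the value `1`. -/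
def condFlip {S : Finset W} (u : S) (v : S) (y : LocalConfig d S) : LocalConfig d S :=
  fun w => if w = v ∧ u ≠ v ∧ (y u : ℕ) = 1 then (y w).rev else y w

/-- The guard `u ≠ v` in `condFlip` makes this hold without a hypothesis on the wires, so `cnotGate`
is unitary even for coinciding wires. -/
theorem condFlip_condFlip {S : Finset W} (u v : S) (y : LocalConfig d S) :
    condFlip u v (condFlip u v y) = y := by
  ext w
  by_cases h : w = v ∧ u ≠ v ∧ (y u : ℕ) = 1
  · obtain ⟨rfl, h1, h2⟩ := h
    simp [condFlip, h1, h2]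
  · by_cases hu : u = v
    · simp [condFlip, hu]
    · have : condFlip u v y u = y u := by simp [condFlip, hu]
      rw [condFlip, this, if_neg h, condFlip, if_neg h]

/-- The controlled-not gate, with control `u` and target `v`. -/
def cnotGate (u v : W) : Gate d where
  support := {u, v}
  card_le := Finset.card_le_two
  op := Matrix.of fun x y => if y = condFlip ⟨u, by simp⟩ ⟨v, by simp⟩ x then 1 else 0
  unitary := by
    rw [Matrix.mem_unitaryGroup_iff]
    ext x y
    rw [Matrix.mul_apply]
    simp only [Matrix.star_apply, Matrix.of_apply, ite_mul, one_mul, zero_mul]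
    rw [Finset.sum_ite_eq', if_pos (Finset.mem_univ _), Matrix.one_apply]
    have : condFlip ⟨u, by simp⟩ ⟨v, by simp⟩ x = condFlip ⟨u, by simp⟩ ⟨v, by simp⟩ y ↔ x = y :=
      ⟨fun h => by rw [← condFlip_condFlip ⟨u, by simp⟩ ⟨v, by simp⟩ x, h, condFlip_condFlip],
        fun h => by rw [h]⟩
    rw [apply_ite star, star_one, star_zero]
    exact if_congr this rfl rfl

theorem cnotGate_apply {u v : W} (h : u ≠ v) (χ : Ket (Config d)) :
    (cnotGate u v).apply χ =
      fun x => χ (fun w => if w = v ∧ (x u : ℕ) = 1 then (x w).rev else x w) := by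
  ext x
  refine (Finset.sum_eq_single (condFlip (S := {u, v}) ⟨u, by simp⟩ ⟨v, by simp⟩
    (localPart _ x)) (fun y _ hy => ?_) (fun hy => absurd (Finset.mem_univ _) hy)).trans ?_
  · exact mul_eq_zero_of_left (if_neg hy) _
  refine (congrArg (· * _) (if_pos rfl)).trans ((one_mul _).trans ?_)
  congr 1
  ext w
  simp only [overrideOn, condFlip, localPart, cnotGate]
  by_cases hw : w = u ∨ w = v
  · simp [hw, h]
  · have : ¬ w = v := fun h' => hw (Or.inr h')
    simp [this]

/-- A basis label of a single wire, seen as the label of that wire. -/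
def localSingleton (w : W) : LocalConfig d {w} ≃ Fin (d w) where
  toFun y := y ⟨w, by simp⟩
  invFun a v := Fin.cast (by rw [Finset.mem_singleton.mp v.2]) a
  left_inv y := by
    ext ⟨v, hv⟩
    obtain rfl := Finset.mem_singleton.mp hv
    rfl
  right_inv a := rfl

/-- The gate `M` on the wire `w`. -/
def siteGate (w : W) (M : Matrix (Fin (d w)) (Fin (d w)) ℂ)
    (hM : M ∈ Matrix.unitaryGroup (Fin (d w)) ℂ) : Gate d where
  support := {w}
  card_le := by simp
  op := M.submatrix (localSingleton w) (localSingleton w)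
  unitary := by
    rw [Matrix.mem_unitaryGroup_iff, Matrix.star_eq_conjTranspose, Matrix.conjTranspose_submatrix,
      Matrix.submatrix_mul_equiv, ← Matrix.star_eq_conjTranspose,
      Matrix.mem_unitaryGroup_iff.mp hM, Matrix.submatrix_one_equiv]

theorem siteGate_apply (w : W) (M : Matrix (Fin (d w)) (Fin (d w)) ℂ)
    (hM : M ∈ Matrix.unitaryGroup (Fin (d w)) ℂ) (χ : Ket (Config d)) (x : Config d) :
    (siteGate w M hM).apply χ x = ∑ a, M (x w) a * χ (Function.update x w a) := by
  simp only [Gate.apply, siteGate]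
  refine Fintype.sum_equiv (localSingleton w) _ _ fun y => ?_
  rw [Matrix.submatrix_apply]
  congr 2
  ext v
  by_cases hv : v = w
  · subst hv; simp [overrideOn, localSingleton]
  · simp [overrideOn, hv]

/-- The layer made of the gates `g i`, `i ∈ s`. -/
noncomputable def Layer.parallel {ι : Type} (s : Finset ι) (g : ι → Gate d)
    (h : (s : Set ι).PairwiseDisjoint fun i => (g i).support) : Layer d where
  gates := s.toList.map g
  disjoint := by
    rw [List.pairwise_map]
    exact s.nodup_toList.pairwise_of_forall_ne fun a ha b hb hab =>
      h (Finset.mem_coe.mpr (Finset.mem_toList.mp ha)) (Finset.mem_coe.mpr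
        (Finset.mem_toList.mp hb)) hab

theorem foldl_phaseGate {ι : Type} (u v : ι → W) (θ : ι → ℕ → ℕ → ℝ) (l : List ι)
    (χ : Ket (Config d)) (x : Config d) :
    (l.map fun i => phaseGate (u i) (v i) (θ i)).foldl (fun χ g => g.apply χ) χ x =
      Complex.exp (2 * (Real.pi : ℂ) * Complex.I *
        ((l.map fun i => θ i (x (u i)) (x (v i))).sum : ℝ)) * χ x := by
  induction l generalizing χ with
  | nil => simp
  | cons i l ih =>
    rw [List.map_cons, List.foldl_cons, ih, phaseGate_apply, ← mul_assoc, ← Complex.exp_add]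
    congr 2
    simp only [List.map_cons, List.sum_cons]
    push_cast; ring

theorem parallel_phaseGate_apply {ι : Type} (s : Finset ι) (u v : ι → W) (θ : ι → ℕ → ℕ → ℝ)
    (h : (s : Set ι).PairwiseDisjoint fun i =>
      (phaseGate (u i) (v i) (θ i) : Gate d).support)
    (χ : Ket (Config d)) (x : Config d) :
    (Layer.parallel s (fun i => phaseGate (u i) (v i) (θ i)) h).apply χ x =
      Complex.exp (2 * (Real.pi : ℂ) * Complex.I *
        (∑ i ∈ s, θ i (x (u i)) (x (v i)) : ℝ)) * χ x := by
  rw [Layer.apply, Layer.parallel, foldl_phaseGate, ← Finset.sum_map_toList]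

/-- Since targets are distinct and never controls, the successive flips do not influence each other
and amount to one simultaneous flip. -/
theorem foldl_cnotGate {ι : Type} (u v : ι → W) (l : List ι) (hv : (l.map v).Nodup)
    (h : ∀ i ∈ l, ∀ j ∈ l, u i ≠ v j) (χ : Ket (Config d)) :
    (l.map fun i => cnotGate (u i) (v i)).foldl (fun χ g => g.apply χ) χ =
      χ ∘ cnotMap {i | i ∈ l} u v := by
  classical
  induction l generalizing χ with
  | nil =>
    ext x
    simp only [List.map_nil, List.foldl_nil, Function.comp_apply]
    congr 1
    ext w
    rw [cnotMap_of_ne]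
    simp
  | cons i l ih =>
    rw [List.map_cons, List.nodup_cons] at hv
    have hiv : ∀ j ∈ {j | j ∈ l}, v i ≠ v j := fun j hj h' =>
      hv.1 (h' ▸ List.mem_map_of_mem hj)
    have hiu : ∀ j ∈ {j | j ∈ l}, u i ≠ v j := fun j hj =>
      h i List.mem_cons_self j (List.mem_cons_of_mem _ hj)
    rw [List.map_cons, List.foldl_cons, ih hv.2 (fun a ha b hb =>
      h a (List.mem_cons_of_mem _ ha) b (List.mem_cons_of_mem _ hb)),
      cnotGate_apply (h i List.mem_cons_self i List.mem_cons_self)]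
    ext x
    simp only [Function.comp_apply]
    congr 1
    ext w
    rw [cnotMap_of_ne x hiu]
    by_cases hw : w = v i
    · subst hw
      rw [cnotMap_of_ne x hiv, cnotMap]
      congr 1
      refine if_congr ⟨fun hx => ⟨i, List.mem_cons_self, hx⟩, ?_⟩ rfl rfl
      rintro ⟨j, hj, h1, h2⟩
      rcases List.mem_cons.mp hj with rfl | hj
      · exact ⟨rfl, h2⟩
      · exact absurd h1 (hiv j hj)
    · rw [if_neg fun h' => hw h'.1, cnotMap, cnotMap]
      congr 1
      refine if_congr ?_ rfl rfl
      simp [hw]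

theorem parallel_cnotGate_apply {ι : Type} (s : Finset ι) (u v : ι → W)
    (hv : Set.InjOn v s) (h : ∀ i ∈ s, ∀ j ∈ s, u i ≠ v j)
    (hd : (s : Set ι).PairwiseDisjoint fun i => (cnotGate (u i) (v i) : Gate d).support)
    (χ : Ket (Config d)) :
    (Layer.parallel s (fun i => cnotGate (u i) (v i)) hd).apply χ = χ ∘ cnotMap s u v := by
  rw [Layer.apply, Layer.parallel, foldl_cnotGate u v]
  · simp
  · exact s.nodup_toList.map_on fun a ha b hb hab =>
      hv (Finset.mem_coe.mpr (Finset.mem_toList.mp ha)) (Finset.mem_coe.mpr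
        (Finset.mem_toList.mp hb)) hab
  · simpa using h

/-- Each gate turns the indicator factor of its own wire into a matrix column. That column does not
involve the remaining wires, so the induction absorbs it into `F`. -/
theorem foldl_siteGate {ι : Type} (w : ι → W) (M : ∀ i, Matrix (Fin (d (w i))) (Fin (d (w i))) ℂ)
    (hM : ∀ i, M i ∈ Matrix.unitaryGroup (Fin (d (w i))) ℂ) (z : Config d)
    (l : List ι) (hl : (l.map w).Nodup) (F : Ket (Config d))
    (hF : ∀ i ∈ l, ∀ x a, F (Function.update x (w i) a) = F x) :
    (l.map fun i => siteGate (w i) (M i) (hM i)).foldl (fun χ g => g.apply χ)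
      (fun x => F x * (l.map fun i => if x (w i) = z (w i) then (1 : ℂ) else 0).prod) =
      fun x => F x * (l.map fun i => M i (x (w i)) (z (w i))).prod := by
  induction l generalizing F with
  | nil => simp
  | cons i l ih =>
    rw [List.map_cons, List.nodup_cons] at hl
    have hi : ∀ j ∈ l, w j ≠ w i := fun j hj h' => hl.1 (h' ▸ List.mem_map_of_mem hj)
    rw [List.map_cons, List.foldl_cons]
    have h1 : (siteGate (w i) (M i) (hM i)).apply (fun x => F x *
        ((i :: l).map fun i => if x (w i) = z (w i) then (1 : ℂ) else 0).prod) =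
        fun x => (F x * M i (x (w i)) (z (w i))) *
          (l.map fun i => if x (w i) = z (w i) then (1 : ℂ) else 0).prod := by
      ext x
      rw [siteGate_apply, Finset.sum_eq_single (z (w i))]
      · rw [hF i List.mem_cons_self, List.map_cons, List.prod_cons, Function.update_self,
          if_pos rfl, one_mul]
        have : (l.map fun j => if Function.update x (w i) (z (w i)) (w j) = z (w j)
            then (1 : ℂ) else 0) = l.map fun j => if x (w j) = z (w j) then (1 : ℂ) else 0 :=
          List.map_congr_left fun j hj => by rw [Function.update_of_ne (hi j hj)]
        rw [this]; ring
      · intro a _ ha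
        simp [ha]
      · simp
    rw [h1, ih hl.2 (fun x => F x * M i (x (w i)) (z (w i)))]
    · ext x
      simp only [List.map_cons, List.prod_cons]
      ring
    · intro j hj x a
      change F (Function.update x (w j) a) * M i (Function.update x (w j) a (w i)) (z (w i)) = _
      rw [hF j (List.mem_cons_of_mem _ hj), Function.update_of_ne (hi j hj).symm]

theorem siteGate_pairwiseDisjoint {ι : Type} {w : ι → W} (hw : Function.Injective w)
    (M : ∀ i, Matrix (Fin (d (w i))) (Fin (d (w i))) ℂ)
    (hM : ∀ i, M i ∈ Matrix.unitaryGroup (Fin (d (w i))) ℂ) (s : Set ι) :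
    s.PairwiseDisjoint fun i => (siteGate (w i) (M i) (hM i)).support := by
  intro i _ j _ hij
  simpa [siteGate, Function.onFun] using fun h => hij (hw h)

/-- One-wire gates on wires in a product of basis states. -/
theorem parallel_siteGate_apply {ι : Type} [Fintype ι] {w : ι → W} (hw : Function.Injective w)
    (M : ∀ i, Matrix (Fin (d (w i))) (Fin (d (w i))) ℂ)
    (hM : ∀ i, M i ∈ Matrix.unitaryGroup (Fin (d (w i))) ℂ) (z : Config d) (F : Ket (Config d))
    (hF : ∀ i x a, F (Function.update x (w i) a) = F x) :
    (Layer.parallel Finset.univ (fun i => siteGate (w i) (M i) (hM i))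
        (siteGate_pairwiseDisjoint hw M hM _)).apply
      (fun x => F x * ∏ i, if x (w i) = z (w i) then (1 : ℂ) else 0) =
      fun x => F x * ∏ i, M i (x (w i)) (z (w i)) := by
  have := foldl_siteGate w M hM z Finset.univ.toList
    (Finset.univ.nodup_toList.map hw) F (fun i _ => hF i)
  simpa only [Layer.apply, Layer.parallel, Finset.prod_map_toList] using this

/-- The layer with a single gate. -/
def Layer.single (g : Gate d) : Layer d := ⟨[g], List.pairwise_singleton _ _⟩

/-- Apply a sequence of layers. -/
def applyLayers (l : List (Layer d)) (χ : Ket (Config d)) : Ket (Config d) :=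
  l.foldl (fun χ L => L.apply χ) χ

theorem applyLayers_cons (L : Layer d) (l : List (Layer d)) (χ : Ket (Config d)) :
    applyLayers (L :: l) χ = applyLayers l (L.apply χ) := rfl

theorem applyLayers_append (l m : List (Layer d)) (χ : Ket (Config d)) :
    applyLayers (l ++ m) χ = applyLayers m (applyLayers l χ) := List.foldl_append

/-- The measurement-free circuit with the given layers. -/
def Circuit.ofLayers (l : List (Layer d)) : Circuit d Unit :=
  l.foldr (fun L C => .layer L C) (.halt ())

theorem ofLayers_onBranches (l : List (Layer d)) (χ : Ket (Config d))
    (R : Unit → Ket (Config d) → Prop) :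
    (Circuit.ofLayers l).OnBranches χ R ↔ R () (applyLayers l χ) := by
  induction l generalizing χ with
  | nil => rfl
  | cons L l ih => exact ih (L.apply χ)

theorem ofLayers_andThen_onBranches {α : Type} (l : List (Layer d)) (D : Unit → Circuit d α)
    (χ : Ket (Config d)) (R : α → Ket (Config d) → Prop) :
    ((Circuit.ofLayers l).andThen D).OnBranches χ R ↔ (D ()).OnBranches (applyLayers l χ) R := by
  induction l generalizing χ with
  | nil => rfl
  | cons L l ih => exact ih (L.apply χ)

theorem ofLayers_andThen_prob [Fintype W] {α : Type} [DecidableEq α] (l : List (Layer d))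
    (D : Unit → Circuit d α) (χ : Ket (Config d)) (a : α) :
    ((Circuit.ofLayers l).andThen D).prob χ a = (D ()).prob (applyLayers l χ) a := by
  induction l generalizing χ with
  | nil => rfl
  | cons L l ih => exact ih (L.apply χ)

theorem ofLayers_andThen_depth {α : Type} (l : List (Layer d)) (D : Unit → Circuit d α) :
    ((Circuit.ofLayers l).andThen D).depth = l.length + (D ()).depth := by
  induction l with
  | nil => simp [Circuit.ofLayers, Circuit.andThen]
  | cons L l ih =>
    have : ((Circuit.ofLayers (L :: l)).andThen D).depth =
      ((Circuit.ofLayers l).andThen D).depth + 1 := rfl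
    rw [this, ih, List.length_cons]; ring

theorem applyLayers_phase {ι : Type} (L : ι → Layer d) (θ : ι → Config d → ℝ)
    (hL : ∀ i χ x, (L i).apply χ x =
      Complex.exp (2 * (Real.pi : ℂ) * Complex.I * (θ i x : ℝ)) * χ x)
    (l : List ι) (χ : Ket (Config d)) (x : Config d) :
    applyLayers (l.map L) χ x = Complex.exp (2 * (Real.pi : ℂ) * Complex.I *
      ((l.map fun i => θ i x).sum : ℝ)) * χ x := by
  induction l generalizing χ with
  | nil => simp [applyLayers]
  | cons i l ih =>
    rw [List.map_cons, applyLayers_cons, ih, hL, ← mul_assoc, ← Complex.exp_add]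
    congr 2
    simp only [List.map_cons, List.sum_cons]
    push_cast; ring

/-- Conjugating a diagonal operator by involutive relabellings of the basis. -/
theorem applyLayers_conj {ι : Type} (L : ι → Layer d) (F : ι → Config d → Config d)
    (hF : ∀ i x, F i (F i x) = x) (hL : ∀ i χ, (L i).apply χ = χ ∘ F i)
    (D : List (Layer d)) (ph : Config d → ℂ) (hD : ∀ χ x, applyLayers D χ x = ph x * χ x)
    (l : List ι) (χ : Ket (Config d)) (x : Config d) :
    applyLayers (l.map L ++ D ++ (l.map L).reverse) χ x =
      ph (l.foldl (fun y i => F i y) x) * χ x := by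
  induction l generalizing χ x with
  | nil => simpa using hD χ x
  | cons i l ih =>
    -- The outermost layer is peeled off at both ends; its two relabellings cancel on the state and
    -- survive only inside the phase.
    have : (i :: l).map L ++ D ++ ((i :: l).map L).reverse =
        L i :: ((l.map L ++ D ++ (l.map L).reverse) ++ [L i]) := by simp
    rw [this, applyLayers_cons, applyLayers_append]
    change (L i).apply _ x = _
    rw [hL, Function.comp_apply, ih, hL, Function.comp_apply, hF, List.foldl_cons]

end Gates

/-! ### Controlled powers of `U` by fan-out of the register -/

section PhaseKickback

variable {t ℓ n : ℕ}

/-- The register qubits followed by the auxiliary qubits, as a single family of wires. -/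
def flatWire (a : Fin (ℓ + n)) : Wire ℓ n n :=
  Sum.map id Sum.inl (finSumFinEquiv.symm a)

theorem flatWire_injective : Function.Injective (flatWire : Fin (ℓ + n) → Wire ℓ n n) :=
  (Function.Injective.sumMap Function.injective_id Sum.inl_injective).comp
    finSumFinEquiv.symm.injective

theorem wireDim_flatWire (a : Fin (ℓ + n)) : wireDim t ℓ n n (flatWire a) = 2 := by
  rw [flatWire]
  rcases finSumFinEquiv.symm a with j | j <;> rfl

theorem flatWire_ne_sys (a : Fin (ℓ + n)) (i : Fin n) : flatWire a ≠ Sum.inr (Sum.inr i) := by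
  rw [flatWire]
  rcases finSumFinEquiv.symm a with j | j <;> simp

/-- The qubits that receive a copy in the step `s` of the fan-out. -/
def copyTargets (ℓ n s : ℕ) : Finset (Fin (ℓ + n)) :=
  Finset.univ.filter fun a => 2 ^ s * ℓ ≤ (a : ℕ) ∧ (a : ℕ) < 2 ^ s * ℓ + 2 ^ s * ℓ

theorem mem_copyTargets {s : ℕ} {a : Fin (ℓ + n)} : a ∈ copyTargets ℓ n s ↔
    2 ^ s * ℓ ≤ (a : ℕ) ∧ (a : ℕ) < 2 ^ s * ℓ + 2 ^ s * ℓ := by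
  simp [copyTargets]

/-- The qubit that is copied to the qubit `a` in the step `s` of the fan-out. -/
def copySource (s : ℕ) (a : Fin (ℓ + n)) : Fin (ℓ + n) :=
  ⟨a - 2 ^ s * ℓ, lt_of_le_of_lt (Nat.sub_le _ _) a.2⟩

theorem copySource_ne {s : ℕ} {a b : Fin (ℓ + n)} (ha : a ∈ copyTargets ℓ n s)
    (hb : b ∈ copyTargets ℓ n s) : copySource s a ≠ b := by
  intro h
  have := congrArg Fin.val h
  rw [mem_copyTargets] at ha hb
  simp only [copySource] at this
  omega

theorem copySource_injOn {s : ℕ} {a b : Fin (ℓ + n)} (ha : a ∈ copyTargets ℓ n s)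
    (hb : b ∈ copyTargets ℓ n s) (h : copySource s a = copySource s b) : a = b := by
  have := congrArg Fin.val h
  rw [mem_copyTargets] at ha hb
  simp only [copySource] at this
  ext
  omega

/-- The step `s` of the fan-out: the first `2 ^ s` copies of the register are copied. -/
noncomputable def copyLayer (t ℓ n s : ℕ) : Layer (wireDim t ℓ n n) :=
  Layer.parallel (copyTargets ℓ n s)
    (fun a => cnotGate (flatWire (copySource s a)) (flatWire a)) (by
      intro a ha b hb hab
      have h1 := copySource_ne ha hb
      have h2 := copySource_ne hb ha
      have h3 := fun h => hab (copySource_injOn ha hb h)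
      simp only [Function.onFun, cnotGate, Finset.disjoint_insert_left, Finset.mem_insert,
        Finset.mem_singleton, Finset.disjoint_singleton_left, flatWire_injective.eq_iff, not_or]
      exact ⟨⟨h3, h1⟩, h2.symm, hab⟩)

/-- The relabelling of the basis by `copyLayer`. -/
noncomputable def copyMap (t ℓ n s : ℕ) :
    Config (wireDim t ℓ n n) → Config (wireDim t ℓ n n) :=
  cnotMap (copyTargets ℓ n s) (fun a => flatWire (copySource s a)) flatWire

theorem copyMap_copyMap (s : ℕ) (x : Config (wireDim t ℓ n n)) :
    copyMap t ℓ n s (copyMap t ℓ n s x) = x :=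
  cnotMap_cnotMap (fun _ ha _ hb h => copySource_ne ha hb (flatWire_injective h)) x

theorem copyLayer_apply (s : ℕ) (χ : Ket (Config (wireDim t ℓ n n))) :
    (copyLayer t ℓ n s).apply χ = χ ∘ copyMap t ℓ n s :=
  parallel_cnotGate_apply _ _ _ flatWire_injective.injOn
    (fun _ ha _ hb h => copySource_ne ha hb (flatWire_injective h)) _ χ

variable [NeZero ℓ]

/-- The register qubit of which the qubit `a` becomes a copy. -/
def copyBit (a : Fin (ℓ + n)) : Fin ℓ := Fin.ofNat ℓ a

/-- Copy blocks have length `ℓ`, so the shift by `2 ^ S * ℓ` preserves the position modulo `ℓ`; the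
targets are still `0`, which turns each controlled-not into a copy. -/
theorem foldl_copyMap {x : Config (wireDim t ℓ n n)} (hx : auxPart x = fun _ => 0) (S : ℕ) :
    (∀ a : Fin (ℓ + n), ((List.range S).foldl (fun y s => copyMap t ℓ n s y) x (flatWire a) : ℕ) =
      if (a : ℕ) < 2 ^ S * ℓ then (x (Sum.inl (copyBit a)) : ℕ) else 0) ∧
    ∀ i : Fin n, (List.range S).foldl (fun y s => copyMap t ℓ n s y) x (Sum.inr (Sum.inr i)) =
      x (Sum.inr (Sum.inr i)) := by
  induction S with
  | zero =>
    refine ⟨fun a => ?_, fun i => rfl⟩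
    simp only [List.range_zero, List.foldl_nil, pow_zero, one_mul]
    refine Fin.addCases (fun j => ?_) (fun i => ?_) a
    · have h1 : flatWire (Fin.castAdd n j) = Sum.inl j := by simp [flatWire]
      have h2 : copyBit (Fin.castAdd n j) = j := by
        ext; simp [copyBit]
      rw [h1, h2, if_pos (by simp)]
    · have h1 : flatWire (Fin.natAdd ℓ i) = Sum.inr (Sum.inl i) := by simp [flatWire]
      rw [h1, if_neg (by simp)]
      exact congrArg Fin.val (congrFun hx i)
  | succ S ih =>
    rw [List.range_succ, List.foldl_append]
    simp only [List.foldl_cons, List.foldl_nil]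
    set y := (List.range S).foldl (fun y s => copyMap t ℓ n s y) x
    obtain ⟨ih1, ih2⟩ := ih
    refine ⟨fun a => ?_, fun i => ?_⟩
    · have hpow : 2 ^ (S + 1) * ℓ = 2 ^ S * ℓ + 2 ^ S * ℓ := by ring
      by_cases ha : a ∈ copyTargets ℓ n S
      · have ha' := mem_copyTargets.mp ha
        have hbit : copyBit (copySource S a) = copyBit a := by
          ext
          simp only [copyBit, copySource, Fin.val_ofNat]
          rw [mul_comm] at ha' ⊢
          exact Nat.sub_mul_mod ha'.1
        have hs : (y (flatWire (copySource S a)) : ℕ) = x (Sum.inl (copyBit a)) := by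
          rw [ih1, hbit, if_pos]
          simp only [copySource]; omega
        have h0 : (y (flatWire a) : ℕ) = 0 := by rw [ih1, if_neg (by omega)]
        have hiff : (∃ b ∈ (copyTargets ℓ n S : Set (Fin (ℓ + n))), flatWire a = flatWire b ∧
            (y (flatWire (copySource S b)) : ℕ) = 1) ↔ (x (Sum.inl (copyBit a)) : ℕ) = 1 := by
          constructor
          · rintro ⟨b, -, hb, h⟩
            rw [← flatWire_injective hb, hs] at h
            exact h
          · intro h
            exact ⟨a, ha, rfl, hs.trans h⟩
        have hlt : (x (Sum.inl (copyBit a)) : ℕ) < 2 := (x (Sum.inl (copyBit a))).2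
        rw [if_pos (by omega), copyMap, cnotMap]
        split_ifs with h
        · rw [Fin.val_rev, h0, wireDim_flatWire, hiff.mp h]
        · rw [hiff] at h
          omega
      · rw [copyMap, cnotMap_of_ne, ih1]
        · rw [mem_copyTargets] at ha
          exact if_congr (by omega) rfl rfl
        · intro b hb h
          exact ha (flatWire_injective h ▸ hb)
    · rw [copyMap, cnotMap_of_ne, ih2]
      intro b _ h
      exact flatWire_ne_sys b i h.symm

/-- The register bit that acts on the qudit `i` in the layer `τ`. -/
def kickBit (τ : Fin ℓ) (i : Fin n) : Fin ℓ := τ + Fin.ofNat ℓ i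

/-- The copy of `kickBit τ i` that acts on the qudit `i` in the layer `τ`. -/
def kickSource (τ : Fin ℓ) (i : Fin n) : Fin (ℓ + n) :=
  -- The block starts at or before `i < n` and the bit is below `ℓ`, so `ℓ + n` qubits suffice even
  -- when the last copy is incomplete.
  ⟨(i : ℕ) / ℓ * ℓ + kickBit τ i, by
    have := Nat.div_mul_le_self (i : ℕ) ℓ
    have := (kickBit τ i).2
    have := i.2
    omega⟩

theorem copyBit_kickSource (τ : Fin ℓ) (i : Fin n) : copyBit (kickSource τ i) = kickBit τ i := by
  ext
  simp [copyBit, kickSource, Nat.mod_eq_of_lt (kickBit τ i).2]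

/-- The source determines the block `i / ℓ` and, through the rotation by `i`, the residue of `i`
modulo `ℓ`. This makes the gates of one `kickLayer` disjoint. -/
theorem kickSource_injective (τ : Fin ℓ) :
    Function.Injective (kickSource τ : Fin n → Fin (ℓ + n)) := by
  intro i j h
  have h1 : kickBit τ i = kickBit τ j := by
    rw [← copyBit_kickSource, h, copyBit_kickSource]
  have h2 := congrArg Fin.val h
  simp only [kickSource, h1, add_left_inj] at h2
  have h3 := congrArg Fin.val (add_left_cancel h1)
  simp only [Fin.val_ofNat] at h3
  ext
  rw [← Nat.div_add_mod' (i : ℕ) ℓ, h2, h3, Nat.div_add_mod']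

/-- Each qudit interacts with one bit of its copy of the register. -/
noncomputable def kickLayer (t n : ℕ) (τ : Fin ℓ) : Layer (wireDim t ℓ n n) :=
  Layer.parallel Finset.univ
    (fun i : Fin n => phaseGate (flatWire (kickSource τ i)) (Sum.inr (Sum.inr i))
      fun a m => (a : ℝ) * m / 2 ^ ((kickBit τ i : ℕ) + 1)) (by
      intro i _ j _ hij
      simp only [Function.onFun, phaseGate, Finset.disjoint_insert_left, Finset.mem_insert,
        Finset.mem_singleton, Finset.disjoint_singleton_left, flatWire_injective.eq_iff, not_or]
      exact ⟨⟨(kickSource_injective τ).ne hij, flatWire_ne_sys _ _⟩,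
        (flatWire_ne_sys _ _).symm, by simpa using hij⟩)

theorem kickLayer_apply (τ : Fin ℓ) (χ : Ket (Config (wireDim t ℓ n n)))
    (x : Config (wireDim t ℓ n n)) :
    (kickLayer t n τ).apply χ x = Complex.exp (2 * (Real.pi : ℂ) * Complex.I *
      (∑ i : Fin n, ((x (flatWire (kickSource τ i)) : ℕ) : ℝ) *
        ((x (Sum.inr (Sum.inr i)) : ℕ) : ℝ) / 2 ^ ((kickBit τ i : ℕ) + 1) : ℝ)) * χ x :=
  parallel_phaseGate_apply _ _ _ _ _ χ x

/-- The layers that apply the controlled powers of `U`, the qubit `j` of the register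
controlling the power `2 ^ (ℓ - 1 - j)`. -/
noncomputable def kickLayers (t ℓ n : ℕ) [NeZero ℓ] : List (Layer (wireDim t ℓ n n)) :=
  (List.range ℓ).map (copyLayer t ℓ n) ++ (List.finRange ℓ).map (kickLayer t n) ++
    ((List.range ℓ).map (copyLayer t ℓ n)).reverse

theorem kickLayers_apply (h : ℓ + n ≤ 2 ^ ℓ * ℓ) (χ : Ket (Config (wireDim t ℓ n n)))
    {x : Config (wireDim t ℓ n n)} (hx : auxPart x = fun _ => 0) :
    applyLayers (kickLayers t ℓ n) χ x = Complex.exp (2 * (Real.pi : ℂ) * Complex.I *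
      (∑ j : Fin ℓ, ((x (Sum.inl j) : ℕ) : ℝ) * (levelSum (sysPart x) : ℝ) /
        2 ^ ((j : ℕ) + 1) : ℝ)) * χ x := by
  rw [kickLayers, applyLayers_conj _ _ copyMap_copyMap copyLayer_apply _ _
    (fun χ x => applyLayers_phase _ _ kickLayer_apply _ χ x)]
  obtain ⟨h1, h2⟩ := foldl_copyMap hx ℓ
  set y := (List.range ℓ).foldl (fun y s => copyMap t ℓ n s y) x
  congr 4
  rw [← List.ofFn_eq_map, List.sum_ofFn, Finset.sum_comm]
  have : ∀ (i : Fin n) (τ : Fin ℓ), ((y (flatWire (kickSource τ i)) : ℕ) : ℝ) *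
      ((y (Sum.inr (Sum.inr i)) : ℕ) : ℝ) / 2 ^ ((kickBit τ i : ℕ) + 1) =
      ((x (Sum.inl (kickBit τ i)) : ℕ) : ℝ) * ((sysPart x i : ℕ) : ℝ) /
        2 ^ ((kickBit τ i : ℕ) + 1) := by
    intro i τ
    rw [h1, h2, if_pos ((kickSource τ i).2.trans_le h), copyBit_kickSource]
    rfl
  simp only [this]
  -- For fixed `i`, the rotation `τ ↦ kickBit τ i` is a bijection: over the `ℓ` layers each qudit
  -- meets every bit once.
  have h3 : ∀ i : Fin n, ∑ τ : Fin ℓ, ((x (Sum.inl (kickBit τ i)) : ℕ) : ℝ) *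
      ((sysPart x i : ℕ) : ℝ) / 2 ^ ((kickBit τ i : ℕ) + 1) =
      ∑ j : Fin ℓ, ((x (Sum.inl j) : ℕ) : ℝ) * ((sysPart x i : ℕ) : ℝ) / 2 ^ ((j : ℕ) + 1) :=
    fun i => Equiv.sum_comp (Equiv.addRight (Fin.ofNat ℓ i)) fun j : Fin ℓ =>
      ((x (Sum.inl j) : ℕ) : ℝ) * ((sysPart x i : ℕ) : ℝ) / 2 ^ ((j : ℕ) + 1)
  simp only [h3]
  rw [Finset.sum_comm]
  refine Finset.sum_congr rfl fun j _ => ?_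
  rw [levelSum, Nat.cast_sum, Finset.mul_sum, Finset.sum_div]

end PhaseKickback

/-! ### Inverse Fourier transform in linear depth -/

/-- The Hadamard matrix. -/
noncomputable def hadamard : Matrix (Fin 2) (Fin 2) ℂ :=
  Matrix.of fun a b => (((Real.sqrt 2)⁻¹ : ℝ) : ℂ) * (-1) ^ ((a : ℕ) * (b : ℕ))

theorem inv_sqrt_two_mul_self :
    (((Real.sqrt 2)⁻¹ : ℝ) : ℂ) * (((Real.sqrt 2)⁻¹ : ℝ) : ℂ) = 1 / 2 := by
  rw [← Complex.ofReal_mul, ← mul_inv, Real.mul_self_sqrt (by norm_num)]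
  push_cast; norm_num

theorem hadamard_mem_unitaryGroup : hadamard ∈ Matrix.unitaryGroup (Fin 2) ℂ := by
  have h := inv_sqrt_two_mul_self
  rw [Matrix.mem_unitaryGroup_iff]
  ext a b
  simp only [Matrix.mul_apply, Fin.sum_univ_two, Matrix.star_apply, hadamard, Matrix.of_apply,
    ← starRingEnd_apply]
  fin_cases a <;> fin_cases b <;> simp at h ⊢ <;> linear_combination 2 * h

section InverseFourier

variable {t ℓ n : ℕ}

/-- The pairs of register qubits that interact in the layer `τ` of the inverse Fourier
transform. -/
def qftPairs (ℓ τ : ℕ) : Finset (Fin ℓ × Fin ℓ) :=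
  Finset.univ.filter fun q => q.1 < q.2 ∧ (q.1 : ℕ) + q.2 = τ

/-- The phase of the interaction of two register qubits in the inverse Fourier transform. -/
noncomputable def qftPhase (x : Config (wireDim t ℓ n n)) (q : Fin ℓ × Fin ℓ) : ℝ :=
  2 ^ (q.1 : ℕ) * ((x (Sum.inl q.1) : ℕ) : ℝ) * ((x (Sum.inl q.2) : ℕ) : ℝ) /
    2 ^ ((q.2 : ℕ) + 1)

/-- A layer of controlled phases of the inverse Fourier transform. -/
noncomputable def qftPhaseLayer (t ℓ n τ : ℕ) : Layer (wireDim t ℓ n n) :=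
  Layer.parallel (qftPairs ℓ τ)
    (fun q => phaseGate (Sum.inl q.1) (Sum.inl q.2) fun a b =>
      -(2 ^ (q.1 : ℕ) * (a : ℝ) * b / 2 ^ ((q.2 : ℕ) + 1))) (by
      -- Two ordered pairs with the same sum that share an element coincide.
      rintro ⟨a, b⟩ h1 ⟨c, e⟩ h2 h3
      simp only [qftPairs, Finset.coe_filter, Finset.mem_univ, true_and, Set.mem_ofPred_eq,
        Fin.lt_def] at h1 h2
      rw [Ne, Prod.mk.injEq, Fin.ext_iff, Fin.ext_iff] at h3
      simp only [Function.onFun, phaseGate, Finset.disjoint_insert_left, Finset.mem_insert,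
        Finset.mem_singleton, Finset.disjoint_singleton_left, Sum.inl.injEq, Fin.ext_iff]
      omega)

theorem qftPhaseLayer_apply (τ : ℕ) (χ : Ket (Config (wireDim t ℓ n n)))
    (x : Config (wireDim t ℓ n n)) :
    (qftPhaseLayer t ℓ n τ).apply χ x = Complex.exp (2 * (Real.pi : ℂ) * Complex.I *
      (-∑ q ∈ qftPairs ℓ τ, qftPhase x q : ℝ)) * χ x := by
  rw [← Finset.sum_neg_distrib]
  exact parallel_phaseGate_apply _ _ _ _ _ χ x

/-- The Hadamard gate on a register qubit. -/
noncomputable def hadamardGate (t n : ℕ) (j : Fin ℓ) : Gate (wireDim t ℓ n n) :=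
  siteGate (Sum.inl j) hadamard hadamard_mem_unitaryGroup

theorem hadamardGate_apply (j : Fin ℓ) (χ : Ket (Config (wireDim t ℓ n n)))
    (x : Config (wireDim t ℓ n n)) :
    (hadamardGate t n j).apply χ x =
      ∑ a : Fin 2, hadamard (x (Sum.inl j)) a * χ (Function.update x (Sum.inl j) a) :=
  siteGate_apply _ _ _ χ x

/-- The layers of the inverse Fourier transform that finish the register qubit `j`. -/
noncomputable def qftStep (t n : ℕ) (j : Fin ℓ) : List (Layer (wireDim t ℓ n n)) :=
  [qftPhaseLayer t ℓ n (2 * j), Layer.single (hadamardGate t n j),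
    qftPhaseLayer t ℓ n (2 * j + 1)]

/-- The number stored in the first `J` register qubits. -/
def lowVal (J : ℕ) (x : Config (wireDim t ℓ n n)) : ℕ :=
  ∑ k ∈ Finset.univ.filter fun k : Fin ℓ => (k : ℕ) < J, (x (Sum.inl k) : ℕ) * 2 ^ (k : ℕ)

theorem lowVal_succ (j : Fin ℓ) (x : Config (wireDim t ℓ n n)) :
    lowVal (j + 1) x = lowVal j x + (x (Sum.inl j) : ℕ) * 2 ^ (j : ℕ) := by
  have : (Finset.univ.filter fun k : Fin ℓ => (k : ℕ) < j + 1) =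
      insert j (Finset.univ.filter fun k : Fin ℓ => (k : ℕ) < j) := by
    ext k; simp [Fin.ext_iff]; omega
  rw [lowVal, this, Finset.sum_insert (by simp), lowVal, add_comm]

theorem lowVal_lt {J : ℕ} (hJ : J ≤ ℓ) (x : Config (wireDim t ℓ n n)) : lowVal J x < 2 ^ J := by
  induction J with
  | zero => simp [lowVal]
  | succ J ih =>
    have h1 := ih (by omega)
    have h2 := lowVal_succ ⟨J, hJ⟩ x
    have h3 : (x (Sum.inl ⟨J, hJ⟩) : ℕ) ≤ 1 := Nat.lt_succ_iff.mp (x (Sum.inl ⟨J, hJ⟩)).2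
    have h4 := Nat.mul_le_mul_right (2 ^ J) h3
    simp only at h2
    rw [h2, pow_succ]
    omega

/-- The phase of the register qubits `k ≥ J` after the controlled powers of `U`. -/
noncomputable def kickPhase (K J : ℕ) (x : Config (wireDim t ℓ n n)) : ℝ :=
  ∑ k ∈ Finset.univ.filter fun k : Fin ℓ => J ≤ (k : ℕ),
    ((x (Sum.inl k) : ℕ) : ℝ) * K / 2 ^ ((k : ℕ) + 1)

/-- The pairs with larger element at least `J` that have interacted in the layers before `τ`. -/
def donePairs (ℓ J τ : ℕ) : Finset (Fin ℓ × Fin ℓ) :=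
  Finset.univ.filter fun q => q.1 < q.2 ∧ J ≤ (q.2 : ℕ) ∧ (q.1 : ℕ) + q.2 < τ

theorem kickPhase_eq (K : ℕ) (j : Fin ℓ) (x : Config (wireDim t ℓ n n)) :
    kickPhase K j x = ((x (Sum.inl j) : ℕ) : ℝ) * K / 2 ^ ((j : ℕ) + 1) +
      kickPhase K (j + 1) x := by
  have : (Finset.univ.filter fun k : Fin ℓ => (j : ℕ) ≤ k) =
      insert j (Finset.univ.filter fun k : Fin ℓ => (j : ℕ) + 1 ≤ k) := by
    ext k; simp [Fin.ext_iff]; omega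
  rw [kickPhase, this, Finset.sum_insert (by simp), kickPhase]

/-- Every pair `(a, j)` with `a < j` has sum below `2 j`, so all corrections to qubit `j` have been
made; they add up to the `lowVal` term. The other pairs pass to the next stage. -/
theorem sum_donePairs_add_even (j : Fin ℓ) (x : Config (wireDim t ℓ n n)) :
    ∑ q ∈ donePairs ℓ j (2 * j), qftPhase x q + ∑ q ∈ qftPairs ℓ (2 * j), qftPhase x q =
      ((x (Sum.inl j) : ℕ) : ℝ) * lowVal j x / 2 ^ ((j : ℕ) + 1) +
        ∑ q ∈ donePairs ℓ (j + 1) (2 * j + 1), qftPhase x q := by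
  have h1 : ((x (Sum.inl j) : ℕ) : ℝ) * lowVal j x / 2 ^ ((j : ℕ) + 1) =
      ∑ q : Fin ℓ × Fin ℓ, if q.2 = j ∧ q.1 < q.2 then qftPhase x q else 0 := by
    rw [Fintype.sum_prod_type]
    have : ∀ a : Fin ℓ, (∑ b : Fin ℓ, if b = j ∧ a < b then qftPhase x (a, b) else 0) =
        if (a : ℕ) < j then qftPhase x (a, j) else 0 := by
      intro a
      rw [Finset.sum_eq_single j]
      · simp
      · intro b _ hb; simp [hb]
      · simp
    simp only [this]
    rw [← Finset.sum_filter, lowVal, Nat.cast_sum, Finset.mul_sum, Finset.sum_div]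
    refine Finset.sum_congr rfl fun a _ => ?_
    simp only [qftPhase]
    push_cast
    ring
  rw [h1, donePairs, donePairs, qftPairs]
  simp only [Finset.sum_filter]
  rw [← Finset.sum_add_distrib, ← Finset.sum_add_distrib]
  refine Finset.sum_congr rfl fun q _ => ?_
  simp only [Fin.lt_def, Fin.ext_iff]
  split_ifs <;> first | omega | simp

theorem sum_donePairs_add_odd (J : ℕ) (x : Config (wireDim t ℓ n n)) :
    ∑ q ∈ donePairs ℓ (J + 1) (2 * J + 1), qftPhase x q +
      ∑ q ∈ qftPairs ℓ (2 * J + 1), qftPhase x q =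
      ∑ q ∈ donePairs ℓ (J + 1) (2 * (J + 1)), qftPhase x q := by
  rw [donePairs, donePairs, qftPairs]
  simp only [Finset.sum_filter]
  rw [← Finset.sum_add_distrib]
  refine Finset.sum_congr rfl fun q _ => ?_
  simp only [Fin.lt_def]
  split_ifs <;> first | omega | simp

theorem lowVal_update (j : Fin ℓ) (x : Config (wireDim t ℓ n n)) (a) :
    lowVal j (Function.update x (Sum.inl j) a) = lowVal j x := by
  refine Finset.sum_congr rfl fun k hk => ?_
  rw [Function.update_of_ne]
  rintro h
  obtain rfl := Sum.inl_injective h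
  simp at hk

theorem kickPhase_update (K : ℕ) (j : Fin ℓ) (x : Config (wireDim t ℓ n n)) (a) :
    kickPhase K (j + 1) (Function.update x (Sum.inl j) a) = kickPhase K (j + 1) x := by
  refine Finset.sum_congr rfl fun k hk => ?_
  rw [Function.update_of_ne]
  rintro h
  obtain rfl := Sum.inl_injective h
  simp at hk

/-- A pair whose larger element exceeds `j` and whose sum is at most `2 j` has its smaller element
below `j`; hence qubit `j` does not occur. -/
theorem sum_donePairs_update (j : Fin ℓ) (x : Config (wireDim t ℓ n n)) (a) :
    ∑ q ∈ donePairs ℓ (j + 1) (2 * j + 1), qftPhase (Function.update x (Sum.inl j) a) q =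
      ∑ q ∈ donePairs ℓ (j + 1) (2 * j + 1), qftPhase x q := by
  refine Finset.sum_congr rfl fun q hq => ?_
  simp only [donePairs, Finset.mem_filter, Finset.mem_univ, true_and] at hq
  rw [qftPhase, Function.update_of_ne, Function.update_of_ne, qftPhase]
  · rintro h
    obtain h' := Sum.inl_injective h
    simp [h'] at hq
  · rintro h
    obtain h' := Sum.inl_injective h
    rw [h'] at hq
    omega

/-- The state after the first `J` register qubits have been finished. -/
noncomputable def qftState (φ : Ket (SysConfig t n)) (ℓ J : ℕ) :
    Ket (Config (wireDim t ℓ n n)) := fun x =>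
  if auxPart x = (fun _ => 0) ∧ lowVal J x = levelSum (sysPart x) % 2 ^ J then
    φ (sysPart x) * (((Real.sqrt 2)⁻¹ : ℝ) : ℂ) ^ (ℓ - J) *
      Complex.exp (2 * (Real.pi : ℂ) * Complex.I * (kickPhase (levelSum (sysPart x)) J x -
        ∑ q ∈ donePairs ℓ J (2 * J), qftPhase x q : ℝ))
  else 0

theorem exp_two_pi_half (e : ℕ) :
    Complex.exp (2 * (Real.pi : ℂ) * Complex.I * ((e : ℝ) / 2 : ℝ)) = (-1) ^ e := by
  rw [← Complex.exp_pi_mul_I, ← Complex.exp_nat_mul]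
  congr 1; push_cast; ring

/-- The Hadamard gate reads the parity of `e` off the relative sign `(-1) ^ e`. -/
theorem hadamard_interference {r : ℕ} (hr : r < 2) (e : ℕ) :
    (((Real.sqrt 2)⁻¹ : ℝ) : ℂ) * (((Real.sqrt 2)⁻¹ : ℝ) : ℂ) * (1 + (-1) ^ r * (-1) ^ e) =
      if r = e % 2 then 1 else 0 := by
  rw [inv_sqrt_two_mul_self]
  rcases Nat.even_or_odd e with h | h
  · rw [h.neg_one_pow, Nat.even_iff.mp h]
    interval_cases r <;> norm_num
  · rw [h.neg_one_pow, Nat.odd_iff.mp h]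
    interval_cases r <;> norm_num

/-- Once the known lower bits of the level are subtracted, the phase left on qubit `j` is half the
integer `levelSum / 2 ^ j`. It is a sign given by bit `j` of the level, which the Hadamard gate
moves into the qubit. -/
theorem qftStep_apply (φ : Ket (SysConfig t n)) (j : Fin ℓ) :
    applyLayers (qftStep t n j) (qftState φ ℓ j) = qftState φ ℓ (j + 1) := by
  ext x
  set s : ℂ := (((Real.sqrt 2)⁻¹ : ℝ) : ℂ)
  set R : Config (wireDim t ℓ n n) → ℝ := fun x => kickPhase (levelSum (sysPart x)) (j + 1) x -
    ∑ q ∈ donePairs ℓ (j + 1) (2 * j + 1), qftPhase x q with hR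
  -- The remainder `R` does not involve qubit `j` and factors out of the Hadamard sum.
  have h1 : (qftPhaseLayer t ℓ n (2 * j)).apply (qftState φ ℓ j) = fun x =>
      if auxPart x = (fun _ => 0) ∧ lowVal j x = levelSum (sysPart x) % 2 ^ (j : ℕ) then
        φ (sysPart x) * s ^ (ℓ - j) * Complex.exp (2 * (Real.pi : ℂ) * Complex.I *
          (((x (Sum.inl j) : ℕ) : ℝ) * (((levelSum (sysPart x) / 2 ^ (j : ℕ) : ℕ) : ℝ) / 2) + R x
            : ℝ))
      else 0 := by
    ext x
    rw [qftPhaseLayer_apply, qftState]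
    split_ifs with h
    · rw [mul_left_comm, ← Complex.exp_add, ← mul_add, ← Complex.ofReal_add]
      congr 4
      have h2 := sum_donePairs_add_even j x
      have h3 : (levelSum (sysPart x) : ℝ) = lowVal j x +
          2 ^ (j : ℕ) * ((levelSum (sysPart x) / 2 ^ (j : ℕ) : ℕ) : ℝ) := by
        rw [h.2]; exact_mod_cast (Nat.mod_add_div _ _).symm
      have h4 : ((x (Sum.inl j) : ℕ) : ℝ) * (((levelSum (sysPart x) / 2 ^ (j : ℕ) : ℕ) : ℝ) / 2) =
          ((x (Sum.inl j) : ℕ) : ℝ) * (levelSum (sysPart x) : ℝ) / 2 ^ ((j : ℕ) + 1) -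
          ((x (Sum.inl j) : ℕ) : ℝ) * lowVal j x / 2 ^ ((j : ℕ) + 1) := by
        conv_rhs => rw [h3]
        rw [pow_succ]
        field_simp
        ring
      rw [h4, kickPhase_eq, hR]
      linarith
    · rw [mul_zero]
  have h2 : ∀ (x : Config (wireDim t ℓ n n)) (a), R (Function.update x (Sum.inl j) a) = R x := by
    intro x a
    simp only [hR]
    rw [sum_donePairs_update]
    exact congrArg (· - _) (kickPhase_update _ j x a)
  have key : ∀ a : Fin (wireDim t ℓ n n (Sum.inl j)),
      (fun x : Config (wireDim t ℓ n n) =>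
        if auxPart x = (fun _ => 0) ∧ lowVal j x = levelSum (sysPart x) % 2 ^ (j : ℕ) then
        φ (sysPart x) * s ^ (ℓ - j) * Complex.exp (2 * (Real.pi : ℂ) * Complex.I *
          (((x (Sum.inl j) : ℕ) : ℝ) * (((levelSum (sysPart x) / 2 ^ (j : ℕ) : ℕ) : ℝ) / 2) + R x
            : ℝ))
        else 0) (Function.update x (Sum.inl j) a) =
        if auxPart x = (fun _ => 0) ∧ lowVal j x = levelSum (sysPart x) % 2 ^ (j : ℕ) then
        φ (sysPart x) * s ^ (ℓ - j) * Complex.exp (2 * (Real.pi : ℂ) * Complex.I *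
          (((a : ℕ) : ℝ) * (((levelSum (sysPart x) / 2 ^ (j : ℕ) : ℕ) : ℝ) / 2) + R x : ℝ))
        else 0 := by
    intro a
    have ha : auxPart (Function.update x (Sum.inl j) a) = auxPart x := by
      ext i; simp [auxPart]
    have hb : sysPart (Function.update x (Sum.inl j) a) = sysPart x := by
      ext i; simp [sysPart]
    beta_reduce
    rw [ha, hb, lowVal_update, h2, Function.update_self]
  have h3 : applyLayers (qftStep t n j) (qftState φ ℓ j) x =
      Complex.exp (2 * (Real.pi : ℂ) * Complex.I *
        (-∑ q ∈ qftPairs ℓ (2 * j + 1), qftPhase x q : ℝ)) *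
      ∑ a : Fin 2, hadamard (x (Sum.inl j)) a *
        if auxPart x = (fun _ => 0) ∧ lowVal j x = levelSum (sysPart x) % 2 ^ (j : ℕ) then
        φ (sysPart x) * s ^ (ℓ - j) * Complex.exp (2 * (Real.pi : ℂ) * Complex.I *
          (((a : ℕ) : ℝ) * (((levelSum (sysPart x) / 2 ^ (j : ℕ) : ℕ) : ℝ) / 2) + R x : ℝ))
        else 0 := by
    change (qftPhaseLayer t ℓ n (2 * j + 1)).apply ((hadamardGate t n j).apply
      ((qftPhaseLayer t ℓ n (2 * j)).apply (qftState φ ℓ j))) x = _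
    rw [h1, qftPhaseLayer_apply, hadamardGate_apply]
    congr 1
    refine Finset.sum_congr rfl fun a _ => ?_
    refine congrArg (hadamard (x (Sum.inl j)) a * ·) (key a)
  rw [h3, Fin.sum_univ_two, qftState]
  have hr : (x (Sum.inl j) : ℕ) < 2 := (x (Sum.inl j)).2
  have hmod : levelSum (sysPart x) % 2 ^ ((j : ℕ) + 1) = levelSum (sysPart x) % 2 ^ (j : ℕ) +
      2 ^ (j : ℕ) * (levelSum (sysPart x) / 2 ^ (j : ℕ) % 2) := by
    rw [pow_succ, Nat.mod_mul]
  -- Agreement modulo `2 ^ (j + 1)` means agreement of the lower `j` bits and of bit `j`.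
  have hiff : lowVal (j + 1) x = levelSum (sysPart x) % 2 ^ ((j : ℕ) + 1) ↔
      lowVal j x = levelSum (sysPart x) % 2 ^ (j : ℕ) ∧
        (x (Sum.inl j) : ℕ) = levelSum (sysPart x) / 2 ^ (j : ℕ) % 2 := by
    rw [hmod, lowVal_succ, mul_comm _ (2 ^ (j : ℕ))]
    constructor
    · intro h
      have ha : lowVal j x = levelSum (sysPart x) % 2 ^ (j : ℕ) := by
        have := congrArg (· % 2 ^ (j : ℕ)) h
        simpa [Nat.mod_eq_of_lt (lowVal_lt j.2.le x)] using this
      refine ⟨ha, ?_⟩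
      rw [ha] at h
      exact Nat.eq_of_mul_eq_mul_left (by positivity) (add_left_cancel h)
    · rintro ⟨ha, hb⟩
      rw [ha, hb]
  by_cases hA : auxPart x = (fun _ => 0) ∧ lowVal j x = levelSum (sysPart x) % 2 ^ (j : ℕ)
  · have hcond : (auxPart x = (fun _ => 0) ∧
        lowVal (j + 1) x = levelSum (sysPart x) % 2 ^ ((j : ℕ) + 1)) ↔
        (x (Sum.inl j) : ℕ) = levelSum (sysPart x) / 2 ^ (j : ℕ) % 2 := by
      rw [hiff]; tauto
    rw [if_congr hcond rfl rfl, if_pos hA, if_pos hA]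
    have hI := hadamard_interference hr (levelSum (sysPart x) / 2 ^ (j : ℕ))
    have hpow : s ^ (ℓ - j) = s * s ^ (ℓ - (j + 1)) := by
      rw [← pow_succ']; congr 1; have := j.2; omega
    have hadd : ∀ a : ℕ, Complex.exp (2 * (Real.pi : ℂ) * Complex.I *
        ((a : ℝ) * (((levelSum (sysPart x) / 2 ^ (j : ℕ) : ℕ) : ℝ) / 2) + R x : ℝ)) =
        ((-1) ^ (levelSum (sysPart x) / 2 ^ (j : ℕ))) ^ a *
          Complex.exp (2 * (Real.pi : ℂ) * Complex.I * (R x : ℝ)) := by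
      intro a
      rw [← exp_two_pi_half, ← Complex.exp_nat_mul, ← Complex.exp_add]
      congr 1; push_cast; ring
    have hfin : Complex.exp (2 * (Real.pi : ℂ) * Complex.I * (kickPhase (levelSum (sysPart x))
        (j + 1) x - ∑ q ∈ donePairs ℓ (j + 1) (2 * (j + 1)), qftPhase x q : ℝ)) =
        Complex.exp (2 * (Real.pi : ℂ) * Complex.I *
          (-∑ q ∈ qftPairs ℓ (2 * j + 1), qftPhase x q : ℝ)) *
        Complex.exp (2 * (Real.pi : ℂ) * Complex.I * (R x : ℝ)) := by
      rw [← Complex.exp_add, ← mul_add, ← Complex.ofReal_add, ← sum_donePairs_add_odd, hR]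
      congr 3; ring
    have hH : ∀ a : Fin 2, hadamard (x (Sum.inl j)) a =
        s * (-1) ^ ((x (Sum.inl j) : ℕ) * (a : ℕ)) := fun a => rfl
    rw [hH, hH, hadd, hadd, hfin, hpow]
    simp only [Fin.val_zero, Fin.val_one, mul_zero, mul_one, pow_zero, pow_one, one_mul]
    have hite : ∀ (p : Prop) [Decidable p] (z : ℂ), (if p then z else 0) =
        (if p then 1 else 0) * z := fun p _ z => by split_ifs <;> simp
    rw [hite, ← hI]
    ring
  · have hB : ¬ (auxPart x = (fun _ => 0) ∧
        lowVal (j + 1) x = levelSum (sysPart x) % 2 ^ ((j : ℕ) + 1)) := by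
      rw [hiff]; tauto
    rw [if_neg hA, if_neg hA, if_neg hB]
    simp

/-- The inverse Fourier transform. -/
noncomputable def qftLayers (t ℓ n : ℕ) : List (Layer (wireDim t ℓ n n)) :=
  (List.finRange ℓ).flatMap (qftStep t n)

theorem qftLayers_apply (φ : Ket (SysConfig t n)) :
    applyLayers (qftLayers t ℓ n) (qftState φ ℓ 0) = qftState φ ℓ ℓ := by
  have h : ∀ J ≤ ℓ, applyLayers (((List.finRange ℓ).take J).flatMap (qftStep t n))
      (qftState φ ℓ 0) = qftState φ ℓ J := by
    intro J hJ
    induction J with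
    | zero => rfl
    | succ J ih =>
      rw [← List.take_concat_get' _ _ (by simpa using hJ), List.flatMap_append,
        applyLayers_append, ih (by omega)]
      simpa using qftStep_apply φ (⟨J, hJ⟩ : Fin ℓ)
  have := h ℓ le_rfl
  rwa [List.take_of_length_le (by simp)] at this

theorem qftLayers_length : (qftLayers t ℓ n).length = 3 * ℓ := by
  simp [qftLayers, qftStep, List.length_flatMap, mul_comm]

end InverseFourier

/-! ### The full circuit, state preparation and readout -/

section Assembly

variable {t ℓ n : ℕ}

/-- The basis label with all wires in `|0⟩`. -/
def zeroConfig (t ℓ b n : ℕ) : Config (wireDim t ℓ b n)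
  | Sum.inl _ => (0 : Fin 2)
  | Sum.inr (Sum.inl _) => (0 : Fin 2)
  | Sum.inr (Sum.inr _) => (0 : Fin (t + 1))

/-- The Hadamard gates on all register qubits. -/
noncomputable def hadamardLayer (t ℓ n : ℕ) : Layer (wireDim t ℓ n n) :=
  Layer.parallel Finset.univ (fun j : Fin ℓ => hadamardGate t n j)
    (siteGate_pairwiseDisjoint Sum.inl_injective _ (fun _ => hadamard_mem_unitaryGroup) _)

theorem prod_ite_eq_zero {m k : ℕ} (y : Fin m → Fin (k + 1)) :
    (∏ i, if y i = 0 then (1 : ℂ) else 0) = if y = (fun _ => 0) then 1 else 0 := by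
  rw [Finset.prod_ite_zero]
  simp [funext_iff]

theorem hadamardLayer_apply (φ : Ket (SysConfig t n)) :
    (hadamardLayer t ℓ n).apply (startKet ℓ n φ) =
      fun x => if auxPart x = (fun _ => 0) then
        φ (sysPart x) * (((Real.sqrt 2)⁻¹ : ℝ) : ℂ) ^ ℓ else 0 := by
  have h := parallel_siteGate_apply (d := wireDim t ℓ n n)
    (Sum.inl_injective : Function.Injective (Sum.inl : Fin ℓ → Wire ℓ n n))
    (fun _ => hadamard) (fun _ => hadamard_mem_unitaryGroup) (zeroConfig t ℓ n n)
    (fun x => if auxPart x = (fun _ => 0) then φ (sysPart x) else 0) (by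
      intro j x a
      have ha : auxPart (Function.update x (Sum.inl j) a) = auxPart x := by
        ext i; simp [auxPart]
      have hb : sysPart (Function.update x (Sum.inl j) a) = sysPart x := by
        ext i; simp [sysPart]
      rw [ha, hb])
  have h0 : startKet ℓ n φ = fun x : Config (wireDim t ℓ n n) =>
      (if auxPart x = (fun _ => 0) then φ (sysPart x) else 0) *
        ∏ j : Fin ℓ, if x (Sum.inl j) = zeroConfig t ℓ n n (Sum.inl j) then (1 : ℂ) else 0 := by
    ext x
    have : (∏ j : Fin ℓ, if x (Sum.inl j) = zeroConfig t ℓ n n (Sum.inl j) then (1 : ℂ) else 0) =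
      if regPart x = (fun _ => 0) then 1 else 0 := prod_ite_eq_zero (regPart x)
    rw [this, startKet, joint]
    split_ifs <;> simp_all [ketTensor, basisKet]
  rw [h0]
  refine h.trans ?_
  ext x
  have hH : ∀ j : Fin ℓ, hadamard (x (Sum.inl j)) (zeroConfig t ℓ n n (Sum.inl j)) =
      (((Real.sqrt 2)⁻¹ : ℝ) : ℂ) := by
    intro j
    change (((Real.sqrt 2)⁻¹ : ℝ) : ℂ) * (-1) ^ ((x (Sum.inl j) : ℕ) * 0) = _
    simp
  rw [Finset.prod_congr rfl fun j _ => hH j]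
  simp

/-- The layers of a circuit for phase estimation. -/
noncomputable def qpeLayers (t ℓ n : ℕ) [NeZero ℓ] : List (Layer (wireDim t ℓ n n)) :=
  hadamardLayer t ℓ n :: (kickLayers t ℓ n ++ qftLayers t ℓ n)

theorem qpeLayers_length [NeZero ℓ] : (qpeLayers t ℓ n).length = 6 * ℓ + 1 := by
  simp only [qpeLayers, kickLayers, List.length_cons, List.length_append, List.length_map,
    List.length_range, List.length_finRange, List.length_reverse, qftLayers_length]
  ring

theorem kickLayers_hadamardLayer_apply [NeZero ℓ] (h : ℓ + n ≤ 2 ^ ℓ * ℓ)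
    (φ : Ket (SysConfig t n)) :
    applyLayers (kickLayers t ℓ n) ((hadamardLayer t ℓ n).apply (startKet ℓ n φ)) =
      qftState φ ℓ 0 := by
  rw [hadamardLayer_apply]
  ext x
  by_cases hx : auxPart x = fun _ => 0
  · rw [kickLayers_apply h _ hx, qftState, if_pos hx, if_pos ⟨hx, by simp [lowVal, Nat.mod_one]⟩,
      mul_comm]
    simp [kickPhase, donePairs]
  -- For nonzero auxiliary labels the copies are not faithful, but the conjugated circuit is still
  -- diagonal and the amplitude stays zero.
  · rw [qftState, if_neg fun h' => hx h'.1]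
    rw [kickLayers, applyLayers_conj _ _ copyMap_copyMap copyLayer_apply _ _
      (fun χ x => applyLayers_phase _ _ kickLayer_apply _ χ x), if_neg hx, mul_zero]

/-- The circuit realizes phase estimation. -/
theorem qpeLayers_apply [NeZero ℓ] (h : ℓ + n ≤ 2 ^ ℓ * ℓ) (hℓ : t * n < 2 ^ ℓ)
    (φ : Ket (SysConfig t n)) :
    applyLayers (qpeLayers t ℓ n) (startKet ℓ n φ) =
      joint (qpe ℓ (phaseU t n ℓ) φ) (fun _ => 0) := by
  rw [qpeLayers, applyLayers_cons, applyLayers_append, kickLayers_hadamardLayer_apply h,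
    qftLayers_apply]
  ext x
  have h1 : lowVal ℓ x = regVal (regPart x) := by
    rw [lowVal, Finset.filter_true_of_mem fun k _ => k.2]; rfl
  have h2 : levelSum (sysPart x) % 2 ^ ℓ = levelSum (sysPart x) :=
    Nat.mod_eq_of_lt ((levelSum_le _).trans_lt hℓ)
  -- With all qubits finished no index reaches `ℓ`, so both phase sums are empty.
  have h3 : kickPhase (levelSum (sysPart x)) ℓ x = 0 :=
    Finset.sum_eq_zero fun k hk => absurd (Finset.mem_filter.mp hk).2 (not_le.mpr k.2)
  have h4 : ∑ q ∈ donePairs ℓ ℓ (2 * ℓ), qftPhase x q = 0 :=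
    Finset.sum_eq_zero fun q hq =>
      absurd (Finset.mem_filter.mp hq).2.2.1 (not_le.mpr q.2.2)
  rw [qftState, joint, qpe_phaseU_apply hℓ, h1, h2, h3, h4]
  split_ifs <;> simp_all

/-- A unitary matrix with a given first column. -/
theorem exists_unitary_column {X : Type} [Fintype X] [DecidableEq X] (x0 : X) {ψ : Ket X}
    (h : ketNormSq ψ = 1) :
    ∃ M ∈ Matrix.unitaryGroup X ℂ, ∀ x, M x x0 = ψ x := by
  have hn : ‖(WithLp.toLp 2 ψ : EuclideanSpace ℂ X)‖ = 1 := by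
    rw [EuclideanSpace.norm_eq, Real.sqrt_eq_one]
    exact h
  have ho : Orthonormal ℂ (({x0} : Set X).domRestrict
      (fun _ => (WithLp.toLp 2 ψ : EuclideanSpace ℂ X))) := by
    refine ⟨fun i => hn, fun i j hij => ?_⟩
    exact absurd (Subtype.ext (i.2.trans j.2.symm)) hij
  -- The single unit vector, placed at index `x0`, is completed to an orthonormal basis whose
  -- coordinates form the columns.
  obtain ⟨b, hb⟩ := ho.exists_orthonormalBasis_extension_of_card_eq (by simp)
  refine ⟨(EuclideanSpace.basisFun X ℂ).toBasis.toMatrix b,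
    OrthonormalBasis.toMatrix_orthonormalBasis_mem_unitary _ _, fun x => ?_⟩
  rw [Module.Basis.toMatrix_apply, hb x0 rfl]
  simp

/-- The layer of one-qudit gates `M` on all qudits. -/
noncomputable def prepLayer {M : Matrix (Fin (t + 1)) (Fin (t + 1)) ℂ}
    (hM : M ∈ Matrix.unitaryGroup (Fin (t + 1)) ℂ) (ℓ b n : ℕ) : Layer (wireDim t ℓ b n) :=
  Layer.parallel Finset.univ (fun i : Fin n => siteGate (Sum.inr (Sum.inr i)) M hM)
    (siteGate_pairwiseDisjoint (w := fun i : Fin n => (Sum.inr (Sum.inr i) : Wire ℓ b n))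
      (Sum.inr_injective.comp Sum.inr_injective) _ (fun _ => hM) _)

theorem prepLayer_apply {M : Matrix (Fin (t + 1)) (Fin (t + 1)) ℂ}
    (hM : M ∈ Matrix.unitaryGroup (Fin (t + 1)) ℂ) {ψ : Ket (Fin (t + 1))}
    (hψ : ∀ m, M m 0 = ψ m) (ℓ b n : ℕ) :
    (prepLayer hM ℓ b n).apply (startKet ℓ b (basisKet (fun _ => 0))) =
      startKet ℓ b (ketPow n ψ) := by
  have h := parallel_siteGate_apply (d := wireDim t ℓ b n)
    (w := fun i : Fin n => (Sum.inr (Sum.inr i) : Wire ℓ b n))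
    (Sum.inr_injective.comp Sum.inr_injective)
    (fun _ => M) (fun _ => hM) (zeroConfig t ℓ b n)
    (fun x => if auxPart x = (fun _ => 0) ∧ regPart x = (fun _ => 0) then 1 else 0) (by
      intro i x a
      have ha : auxPart (Function.update x (Sum.inr (Sum.inr i)) a) = auxPart x := by
        ext i; simp [auxPart]
      have hb : regPart (Function.update x (Sum.inr (Sum.inr i)) a) = regPart x := by
        ext i; simp [regPart]
      rw [ha, hb])
  have h0 : startKet ℓ b (basisKet (fun _ => 0)) = fun x : Config (wireDim t ℓ b n) =>
      (if auxPart x = (fun _ => 0) ∧ regPart x = (fun _ => 0) then 1 else 0) *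
        ∏ i : Fin n, if x (Sum.inr (Sum.inr i)) = zeroConfig t ℓ b n (Sum.inr (Sum.inr i))
          then (1 : ℂ) else 0 := by
    ext x
    have : (∏ i : Fin n, if x (Sum.inr (Sum.inr i)) = zeroConfig t ℓ b n (Sum.inr (Sum.inr i))
        then (1 : ℂ) else 0) = if sysPart x = (fun _ => 0) then 1 else 0 :=
      prod_ite_eq_zero (sysPart x)
    rw [this, startKet, joint]
    split_ifs <;> simp_all [ketTensor, basisKet]
  rw [h0]
  refine h.trans ?_
  ext x
  have hH : ∀ i : Fin n, M (x (Sum.inr (Sum.inr i))) (zeroConfig t ℓ b n (Sum.inr (Sum.inr i))) =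
      ψ (sysPart x i) := fun i => hψ _
  rw [Finset.prod_congr rfl fun i _ => hH i, startKet, joint]
  split_ifs <;> simp_all [ketTensor, basisKet, ketPow]

/-- A family of wire labels is the same as its register, auxiliary and system parts. -/
def configEquiv (t ℓ b n : ℕ) :
    Config (wireDim t ℓ b n) ≃ (Fin b → Fin 2) × (SysConfig t n × RegConfig ℓ) where
  toFun x := (auxPart x, (sysPart x, regPart x))
  invFun y
    | Sum.inl j => y.2.2 j
    | Sum.inr (Sum.inl i) => y.1 i
    | Sum.inr (Sum.inr i) => y.2.1 i
  left_inv x := by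
    ext w
    rcases w with w | w | w <;> rfl
  right_inv y := rfl

theorem ketNormSq_joint {b : ℕ} (f : Ket (SysConfig t n × RegConfig ℓ)) (a : Fin b → Fin 2) :
    ketNormSq (joint f a) = ketNormSq f := by
  rw [ketNormSq, ← (configEquiv t ℓ b n).symm.sum_comp, Fintype.sum_prod_type,
    Finset.sum_eq_single a]
  · refine Finset.sum_congr rfl fun z _ => ?_
    have : joint f a ((configEquiv t ℓ b n).symm (a, z)) = f z := if_pos rfl
    rw [this]
  · intro a' _ ha
    refine Finset.sum_eq_zero fun z _ => ?_
    have : joint f a ((configEquiv t ℓ b n).symm (a', z)) = 0 := if_neg ha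
    simp [this]
  · simp

theorem ketNormSq_smul {X : Type} [Fintype X] (z : ℂ) (χ : Ket X) :
    ketNormSq (z • χ) = ‖z‖ ^ 2 * ketNormSq χ := by
  simp [ketNormSq, Finset.mul_sum, mul_pow]

theorem ketNormSq_ketTensor {X Y : Type} [Fintype X] [Fintype Y] (f : Ket X) (g : Ket Y) :
    ketNormSq (ketTensor f g) = ketNormSq f * ketNormSq g := by
  simp [ketNormSq, ketTensor, Fintype.sum_prod_type, Finset.sum_mul_sum, mul_pow]

theorem exists_regVal_eq {k : ℕ} (hk : k < 2 ^ ℓ) : ∃ r : RegConfig ℓ, regVal r = k :=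
  ⟨finFunctionFinEquiv.symm ⟨k, hk⟩, by rw [regVal_eq, Equiv.apply_symm_apply]⟩

theorem ketNormSq_regKet {k : ℕ} (hk : k < 2 ^ ℓ) : ketNormSq (regKet ℓ k) = 1 := by
  obtain ⟨r, hr⟩ := exists_regVal_eq hk
  rw [ketNormSq, Finset.sum_eq_single r]
  · simp [regKet, hr]
  · intro q _ hq
    rw [regKet, if_neg fun h => hq (regVal_injective (h.trans hr.symm))]
    simp
  · simp

/-- The register outcome `r`. -/
def registerOutcome (t b n : ℕ) (r : RegConfig ℓ) : LocalConfig (wireDim t ℓ b n)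
    (Finset.univ.map ⟨Sum.inl, Sum.inl_injective⟩) :=
  localPart _ ((configEquiv t ℓ b n).symm (fun _ => 0, fun _ => 0, r))

/-- The outcome `o` of a measurement of the register, as a register label. -/
def outcomeReg {b : ℕ} (o : LocalConfig (wireDim t ℓ b n)
    (Finset.univ.map ⟨Sum.inl, Sum.inl_injective⟩)) : RegConfig ℓ :=
  fun j => o ⟨Sum.inl j, by simp⟩

theorem localPart_eq_iff {b : ℕ} (x : Config (wireDim t ℓ b n)) (o : LocalConfig (wireDim t ℓ b n)
    (Finset.univ.map ⟨Sum.inl, Sum.inl_injective⟩)) :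
    localPart _ x = o ↔ regPart x = outcomeReg o := by
  constructor
  · rintro rfl; rfl
  · intro h
    ext ⟨w, hw⟩
    obtain ⟨j, -, rfl⟩ := Finset.mem_map.mp hw
    exact congrArg Fin.val (congrFun h j)

/-- The state left when the value `k` is read from the register. -/
theorem collapse_joint_qpe {b : ℕ} (hℓ : t * n < 2 ^ ℓ) {p : ℝ} (hp0 : 0 ≤ p) (hp1 : p ≤ 1)
    (a : Fin b → Fin 2) (o : LocalConfig (wireDim t ℓ b n)
      (Finset.univ.map ⟨Sum.inl, Sum.inl_injective⟩)) :
    collapse _ o (joint (qpe ℓ (phaseU t n ℓ) (ketPow n (psi t p))) a) =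
      ((Real.sqrt (successP t n p (regVal (outcomeReg o))) : ℝ) : ℂ) •
        joint (ketTensor (dicke t n (regVal (outcomeReg o)))
          (regKet ℓ (regVal (outcomeReg o)))) a := by
  ext x
  simp only [collapse, joint, Pi.smul_apply, smul_eq_mul, qpe_phaseU_apply hℓ, ketTensor, regKet,
    localPart_eq_iff, regVal_injective.eq_iff]
  by_cases h1 : regPart x = outcomeReg o
  · by_cases h2 : auxPart x = a
    · rw [if_pos h1, if_pos h2, if_pos h2, if_pos h1, h1, mul_one]
      split_ifs with h3
      · rw [ketPow_psi_apply_eq_dicke hp0 hp1, h3]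
      · rw [dicke_apply, if_neg (Ne.symm h3), mul_zero]
    · simp [h2]
  · simp [h1]

theorem outcomeReg_eq_iff {b : ℕ} (o : LocalConfig (wireDim t ℓ b n)
    (Finset.univ.map ⟨Sum.inl, Sum.inl_injective⟩)) (r : RegConfig ℓ) :
    outcomeReg o = r ↔ o = registerOutcome t b n r := by
  rw [registerOutcome, eq_comm, eq_comm (a := o), localPart_eq_iff]
  rfl

theorem measureRegister_onBranches (b : ℕ) (χ : Ket (Config (wireDim t ℓ b n)))
    (R : ℕ → Ket (Config (wireDim t ℓ b n)) → Prop) :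
    (measureRegister t ℓ b n).OnBranches χ R ↔
      ∀ o, R (regVal (outcomeReg o)) (collapse _ o χ) := Iff.rfl

theorem measureRegister_prob (b : ℕ) (χ : Ket (Config (wireDim t ℓ b n))) (r : RegConfig ℓ) :
    (measureRegister t ℓ b n).prob χ (regVal r) =
      ketNormSq (collapse _ (registerOutcome t b n r) χ) := by
  change (∑ o, if regVal (outcomeReg o) = regVal r then ketNormSq (collapse _ o χ) else 0) = _
  simp only [regVal_injective.eq_iff, outcomeReg_eq_iff]
  simp

theorem measureRegister_depth (t ℓ b n : ℕ) : (measureRegister t ℓ b n).depth = 1 := by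
  change (Finset.univ.sup fun _ => 0) + 1 = 1
  simp

theorem attempt_ofLayers_depth {b : ℕ} (prep : Layer (wireDim t ℓ b n))
    (l : List (Layer (wireDim t ℓ b n))) :
    (attempt prep (Circuit.ofLayers l)).depth = l.length + 2 := by
  change ((Circuit.ofLayers l).andThen fun _ => measureRegister t ℓ b n).depth + 1 = _
  rw [ofLayers_andThen_depth, measureRegister_depth]

theorem ketNormSq_success {b k : ℕ} (hℓ : t * n < 2 ^ ℓ) (hk : k ≤ t * n) {p : ℝ}
    (hP : 0 ≤ successP t n p k) (a : Fin b → Fin 2) :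
    ketNormSq (((Real.sqrt (successP t n p k) : ℝ) : ℂ) •
      joint (ketTensor (dicke t n k) (regKet ℓ k)) a) = successP t n p k := by
  rw [ketNormSq_smul, ketNormSq_joint, ketNormSq_ketTensor, ketNormSq_dicke hk,
    ketNormSq_regKet (hk.trans_lt hℓ), Complex.norm_real, Real.norm_eq_abs, sq_abs,
    Real.sq_sqrt hP]
  ring

end Assembly

/-! ### Size of the register and final constants -/

theorem lt_two_pow_readoutBits (t n : ℕ) : t * n < 2 ^ readoutBits t n := by
  have h := Nat.le_ceil (Real.logb 2 ((t : ℝ) * n + 1))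
  rw [Real.logb_le_iff_le_rpow (by norm_num) (by positivity), Real.rpow_natCast] at h
  change _ ≤ (2 : ℝ) ^ readoutBits t n at h
  generalize readoutBits t n = ℓ at h ⊢
  have : t * n + 1 ≤ 2 ^ ℓ := by exact_mod_cast h
  omega

/-- Rounding up costs less than one bit, and `log 2 ≤ log (t n + 1)`, so `ℓ ≤ (2 / log 2) log (t n +
1)`; finally `2 / log 2 < 3`. -/
theorem readoutBits_le_log {t n : ℕ} (h : 1 ≤ t * n) :
    (readoutBits t n : ℝ) ≤ 3 * Real.log ((t : ℝ) * n + 1) := by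
  have h1 : (1 : ℝ) ≤ (t : ℝ) * n := by exact_mod_cast h
  have h2 : Real.log 2 ≤ Real.log ((t : ℝ) * n + 1) :=
    Real.log_le_log (by norm_num) (by linarith)
  have h3 := Real.log_two_gt_d9
  have h4 : (readoutBits t n : ℝ) < Real.logb 2 ((t : ℝ) * n + 1) + 1 :=
    Nat.ceil_lt_add_one (Real.logb_nonneg (by norm_num) (by linarith))
  rw [Real.logb, div_add_one (by linarith), lt_div_iff₀ (by linarith)] at h4
  nlinarith [Nat.cast_nonneg (α := ℝ) (readoutBits t n)]

theorem mainTheorem3 :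
    ∃ c : ℝ, ∀ (t n : ℕ) (s : ℝ), 2 * s = (t : ℝ) → 1 ≤ t → 1 ≤ n →
      ∃ (b : ℕ) (Q : Circuit (wireDim t (readoutBits t n) b n) Unit),
        RealizesQPE Q (phaseU t n (readoutBits t n)) ∧
        ((readoutBits t n + b : ℕ) : ℝ) ≤ c * (Real.log (2 * s * n + 1) + n) ∧
        ∀ (k : ℕ) (p : ℝ), k ≤ t * n → p = (k : ℝ) / (2 * s * n) →
          -- phase estimation on the product state
          qpe (readoutBits t n) (phaseU t n (readoutBits t n)) (ketPow n (psi t p)) =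
            ∑ j ∈ Finset.range (t * n + 1), ((Real.sqrt (successP t n p j) : ℝ) : ℂ) •
              ketTensor (dicke t n j) (regKet (readoutBits t n) j) ∧
          ∃ prep : Layer (wireDim t (readoutBits t n) b n),
            -- the product state is prepared by one layer of one-qudit gates
            (∀ g ∈ prep.gates, g.support.card ≤ 1) ∧
            prep.apply (startKet (readoutBits t n) b (basisKet (fun _ => 0))) =
              startKet (readoutBits t n) b (ketPow n (psi t p)) ∧
            -- depth of one attempt
            ((attempt prep Q).depth : ℝ) ≤ c * Real.log (2 * s * n + 1) ∧
            -- if `k` is read, then the system is exactly in the Dicke state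
            (attempt prep Q).OnBranches
              (startKet (readoutBits t n) b (basisKet (fun _ => 0)))
              (fun y χ => y = k → ∃ (z : ℂ) (a : Fin b → Fin 2),
                χ = z • joint (ketTensor (dicke t n k) (regKet (readoutBits t n) k)) a) ∧
            -- success probability
            (attempt prep Q).prob
              (startKet (readoutBits t n) b (basisKet (fun _ => 0))) k = successP t n p k ∧
            -- expected number of independent attempts up to the first success
            HasSum (fun r : ℕ => ((r : ℝ) + 1) * ((1 - successP t n p k) ^ r * successP t n p k))
              (successP t n p k)⁻¹ ∧
            (successP t n p k)⁻¹ ≤ c * Real.sqrt (s * n) := by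
  -- The depth dictates the constant: `6 ℓ + 1` layers of `Q`, one of preparation and one
  -- measurement give `6 ℓ + 3 ≤ 9 ℓ ≤ 27 log (t n + 1)`. The other bounds need less.
  refine ⟨27, fun t n s hs ht hn => ?_⟩
  have hN : 1 ≤ t * n := Nat.one_le_iff_ne_zero.mpr (Nat.mul_ne_zero (by omega) (by omega))
  have hℓ := lt_two_pow_readoutBits t n
  have hlog := readoutBits_le_log hN
  have hNr : (1 : ℝ) ≤ (t : ℝ) * n := by exact_mod_cast hN
  rw [hs]
  set ℓ := readoutBits t n
  have hℓ0 : 1 ≤ ℓ := by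
    rcases Nat.eq_zero_or_pos ℓ with h | h
    · rw [h] at hℓ; omega
    · exact h
  have : NeZero ℓ := ⟨by omega⟩
  -- From `n + 1 ≤ t n + 1 ≤ 2 ^ ℓ`: thus `ℓ` doublings reach all register and auxiliary qubits.
  have hcopies : ℓ + n ≤ 2 ^ ℓ * ℓ := by
    have h1 : n ≤ t * n := Nat.le_mul_of_pos_left n ht
    have h2 : (n + 1) * ℓ ≤ 2 ^ ℓ * ℓ := Nat.mul_le_mul_right ℓ (by omega)
    have h3 : n ≤ n * ℓ := Nat.le_mul_of_pos_right n hℓ0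
    rw [add_mul] at h2
    omega
  have hlog0 : 0 ≤ Real.log ((t : ℝ) * n + 1) := Real.log_nonneg (by linarith)
  have hQ := fun φ : Ket (SysConfig t n) => qpeLayers_apply hcopies hℓ φ
  refine ⟨n, Circuit.ofLayers (qpeLayers t ℓ n), ?_, ?_, fun k p hk hp => ?_⟩
  · intro φ
    rw [ofLayers_onBranches]
    exact ⟨1, fun _ => 0, by rw [one_smul, hQ]⟩
  · push_cast
    have : (0 : ℝ) ≤ n := Nat.cast_nonneg n
    linarith
  have hpN : p = (k : ℝ) / ((t * n : ℕ) : ℝ) := by rw [hp]; push_cast; rfl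
  have hkN : (k : ℝ) ≤ (t : ℝ) * n := by exact_mod_cast hk
  have hp0 : 0 ≤ p := by rw [hp]; positivity
  have hp1 : p ≤ 1 := by rw [hp]; exact div_le_one_of_le₀ hkN (by linarith)
  have hP := successP_pos hk hN hpN
  obtain ⟨M, hM, hMψ⟩ := exists_unitary_column 0 (ketNormSq_psi t hp0 hp1)
  have hprep := prepLayer_apply hM hMψ ℓ n n
  refine ⟨qpe_ketPow_psi hℓ hp0 hp1, prepLayer hM ℓ n n, ?_, hprep, ?_, ?_, ?_,
    hasSum_geometric_mean hP (successP_le_one hk hp0 hp1), ?_⟩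
  · intro g hg
    obtain ⟨i, -, rfl⟩ := List.mem_map.mp hg
    exact (Finset.card_singleton _).le
  · rw [attempt_ofLayers_depth, qpeLayers_length]
    have : (1 : ℝ) ≤ ℓ := by exact_mod_cast hℓ0
    push_cast
    linarith
  · change ((Circuit.ofLayers (qpeLayers t ℓ n)).andThen _).OnBranches _ _
    rw [ofLayers_andThen_onBranches, hprep, hQ, measureRegister_onBranches]
    intro o ho
    refine ⟨((Real.sqrt (successP t n p k) : ℝ) : ℂ), fun _ => 0, ?_⟩
    rw [collapse_joint_qpe hℓ hp0 hp1, ho]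
  · change ((Circuit.ofLayers (qpeLayers t ℓ n)).andThen _).prob _ _ = _
    obtain ⟨r, hr⟩ := exists_regVal_eq (hk.trans_lt hℓ)
    rw [ofLayers_andThen_prob, hprep, hQ, ← hr, measureRegister_prob,
      collapse_joint_qpe hℓ hp0 hp1, (outcomeReg_eq_iff _ r).mpr rfl, hr,
      ketNormSq_success hℓ hk hP.le]
  · have h1 := sqrt_le_successP hk hN hpN
    have h2 : (successP t n p k)⁻¹ ≤ 2 * Real.sqrt ((t * n : ℕ) : ℝ) := by
      rwa [inv_le_iff_one_le_mul₀' hP]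
    refine h2.trans ?_
    have h3 : ((t * n : ℕ) : ℝ) = 2 * (s * n) := by push_cast; rw [← hs]; ring
    have h4 : Real.sqrt 2 ≤ 2 := by
      rw [Real.sqrt_le_left (by norm_num)]; norm_num
    rw [h3, Real.sqrt_mul (by norm_num)]
    nlinarith [Real.sqrt_nonneg (s * n)]
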